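/- Let $K\ge 0$ and consider a network with terminals $T_0,\dots,T_{K+1}$: a source terminal $T_0$, relays $T_1,\dots,T_K$ and a destination $T_{K+1}$. A discrete memoryless channel $p(y_1,\dots,y_{K+1}\mid x_0,\dots,x_K)$ with finite alphabets $\mathcal X_0,\dots,\mathcal X_K,\mathcal Y_1,\dots,\mathcal Y_{K+1}$ is given, where $x_i$ and $y_i$ are the channel input and output of $T_i$. Let $(S_{0,j},\dots,S_{K+1,j})_{j\ge1}$ be i.i.d. copies of a tuple $(S_0,\dots,S_{K+1})$ with an arbitrary joint distribution on a finite alphabet $\mathcal S_0\times\dots\times\mathcal S_{K+1}$; $T_0$ observes the source $S_0$, and $T_i$, $1\le i\le K+1$, observes the side information $S_i$. An $(m,n)$ code consists of an encoder $X_0^n=f_0(S_0^m)$, relay functions $X_{i,t}=f_{i,t}(Y_{i,1},\dots,Y_{i,t-1},S_i^m)$ for $1\le i\le K$, $1\le t\le n$, and a decoder $\hat S_0^m=g(Y_{K+1}^n,S_{K+1}^m)\in\mathcal S_0^m$; its error probability is $P_e^{(m,n)}=\Pr\{\hat S_0^m\ne S_0^m\}$, averaged over the sources and the channel. A rate $r\ge0$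 is achievable if there is a sequence of $(m,n)$ codes with $m,n\to\infty$, $m/n\ge r$ and $P_e^{(m,n)}\to0$. The source-channel capacity is the supremum in $[0,\infty]$ of all achievable rates (with value $0$ if there are none). Suppose that the network is physically degraded, i.e. for every distribution $p(x_0,\dots,x_K)$ of the inputs and every $i=1,\dots,K$, $$(X_0,\dots,X_{i-1})\to(Y_i,X_i,\dots,X_K)\to(Y_{i+1},\dots,Y_{K+1})$$ is a Markov chain, and that $S_0\to S_1\to\cdots\to S_{K+1}$ is a Markov chain. Then the source-channel capacity equals $$\sup_{p(x_0,\dots,x_K)}\ \min_{i=1,\dots,K+1}\ \frac{I(X_0,\dots,X_{i-1};\,Y_i\mid X_i,\dots,X_K)}{H(S_0\mid S_i)},$$ where the supremum is over all joint distributions of the channel inputs (for $i=K+1$ there is no conditioning), the information measures use a common base of the logarithm, and a quotient with $H(S_0\mid S_i)=0$ is read as $+\infty$. -/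

import Mathlib

open Filter Topology
open scoped ENNReal NNReal

namespace RelayNetwork

noncomputable section

/-! ### Finite-alphabet probability and information measures

Random variables are functions on a sample space carrying a probability mass function. -/

/-- `Pr{f = a}` under `μ`. -/
def prob {Ω A : Type*} (μ : PMF Ω) (f : Ω → A) (a : A) : ℝ :=
  ((μ.map f) a).toReal

/-- `A → B → C` is a Markov chain: `A` and `C` are conditionally independent given `B`. -/
def IsMarkov {Ω A B C : Type*} (μ : PMF Ω) (f : Ω → A) (g : Ω → B) (h : Ω → C) : Prop :=
  ∀ a b c, prob μ (fun ω => (f ω, g ω, h ω)) (a, b, c) * prob μ g b =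
    prob μ (fun ω => (f ω, g ω)) (a, b) * prob μ (fun ω => (g ω, h ω)) (b, c)

/-- Conditional entropy `H(A|B) = -∑ p(a,b) log p(a|b)`, in nats. -/
def condEntropy {Ω A B : Type*} [Fintype A] [Fintype B] (μ : PMF Ω)
    (f : Ω → A) (g : Ω → B) : ℝ :=
  -∑ a, ∑ b, prob μ (fun ω => (f ω, g ω)) (a, b) *
    Real.log (prob μ (fun ω => (f ω, g ω)) (a, b) / prob μ g b)

/-- Conditional mutual information `I(A;B|C) = H(A|C) - H(A|B,C)`, in nats. -/
def condMutualInfo {Ω A B C : Type*} [Fintype A] [Fintype B] [Fintype C] (μ : PMF Ω)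
    (f : Ω → A) (g : Ω → B) (h : Ω → C) : ℝ :=
  condEntropy μ f h - condEntropy μ f (fun ω => (g ω, h ω))

/-! ### The relay network

There are `K + 2` terminals `T_0, …, T_{K+1}`.
* `X j`, `j : Fin (K+1)`, is the input alphabet of terminal `T_j` (`j = 0, …, K`);
* `Y j`, `j : Fin (K+1)`, is the output alphabet of terminal `T_{j+1}`;
* `S i`, `i : Fin (K+2)`, is the alphabet of the source (`i = 0`) or of the side information
  of terminal `T_i`.

So the terminal with channel output `Y j` has side information `S j.succ`, and its own channel
input, if it is a relay, is the one with index `j + 1`. -/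

/-- An `(m,n)` joint source-channel code. The `i`-th relay function belongs to the terminal
`T_{i+1}`; at time `t` it uses only the outputs received strictly before `t`. -/
structure Code {K : ℕ} (X Y : Fin (K + 1) → Type*) (S : Fin (K + 2) → Type*) (m n : ℕ) where
  enc : (Fin m → S 0) → Fin n → X 0
  relay : ∀ (i : Fin K) (t : Fin n),
    (Fin t → Y i.castSucc) → (Fin m → S i.castSucc.succ) → X i.succ
  dec : (Fin n → Y (Fin.last K)) → (Fin m → S (Fin.last K).succ) → (Fin m → S 0)

namespace Code

variable {K : ℕ} {X Y : Fin (K + 1) → Type*} {S : Fin (K + 2) → Type*} {m n : ℕ}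

/-- The channel inputs `(x_{0,t}, …, x_{K,t})` produced by the code at time `t`, when the
source and side information samples are `s` and the channel outputs are `y`. -/
def input (c : Code X Y S m n) (s : Fin m → ∀ i, S i) (y : Fin n → ∀ j, Y j) (t : Fin n) :
    ∀ j, X j :=
  Fin.cases (motive := X) (c.enc (fun k => s k 0) t)
    (fun i => c.relay i t (fun u => y (Fin.castLE t.isLt.le u) i.castSucc)
      (fun k => s k i.castSucc.succ))

open scoped Classical in
/-- Probability of error: the samples `s` are i.i.d. with law `q`, and given the past the
outputs at time `t` are drawn from the memoryless channel `W` with the current inputs. -/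
def errorProb [∀ j, Fintype (Y j)] [∀ i, Fintype (S i)] (c : Code X Y S m n)
    (W : (∀ j, X j) → PMF (∀ j, Y j)) (q : PMF (∀ i, S i)) : ℝ :=
  ∑ s : Fin m → ∀ i, S i, ∑ y : Fin n → ∀ j, Y j,
    if c.dec (fun t => y t (Fin.last K)) (fun k => s k (Fin.last K).succ) ≠ fun k => s k 0 then
      (∏ k, (q (s k)).toReal) * ∏ t, (W (c.input s y t) (y t)).toReal
    else 0

end Code

section Network

variable {K : ℕ} {X Y : Fin (K + 1) → Type*} {S : Fin (K + 2) → Type*}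

/-- The source-channel code rate `r` (source samples per channel use) is achievable. -/
def Achievable [∀ j, Fintype (Y j)] [∀ i, Fintype (S i)]
    (W : (∀ j, X j) → PMF (∀ j, Y j)) (q : PMF (∀ i, S i)) (r : ℝ≥0) : Prop :=
  ∃ (m n : ℕ → ℕ) (c : ∀ k, Code X Y S (m k) (n k)),
    (∀ k, 0 < n k ∧ (r : ℝ) ≤ (m k : ℝ) / (n k : ℝ)) ∧
    Tendsto m atTop atTop ∧ Tendsto n atTop atTop ∧
    Tendsto (fun k => (c k).errorProb W q) atTop (𝓝 0)

/-- The supremum of the achievable rates, in `[0, ∞]`; it is `0` if no rate is achievable. -/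
def sourceChannelCapacity [∀ j, Fintype (Y j)] [∀ i, Fintype (S i)]
    (W : (∀ j, X j) → PMF (∀ j, Y j)) (q : PMF (∀ i, S i)) : ℝ≥0∞ :=
  ⨆ (r : ℝ≥0) (_ : Achievable W q r), (r : ℝ≥0∞)

/-- The joint law of the channel inputs and outputs for the input distribution `p`. -/
def jointLaw (W : (∀ j, X j) → PMF (∀ j, Y j)) (p : PMF (∀ j, X j)) :
    PMF ((∀ j, X j) × (∀ j, Y j)) :=
  p.bind fun x => (W x).map (Prod.mk x)

/-- Entries `0, …, j` of a tuple. -/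
def upTo {N : ℕ} {Z : Fin N → Type*} (j : Fin N) (z : ∀ k, Z k) : ∀ k : {k // k ≤ j}, Z k :=
  fun k => z k

/-- Entries `0, …, j - 1` of a tuple. -/
def before {N : ℕ} {Z : Fin N → Type*} (j : Fin N) (z : ∀ k, Z k) : ∀ k : {k // k < j}, Z k :=
  fun k => z k

/-- Entries `j + 1, j + 2, …` of a tuple. -/
def after {N : ℕ} {Z : Fin N → Type*} (j : Fin N) (z : ∀ k, Z k) : ∀ k : {k // j < k}, Z k :=
  fun k => z k

/-- Physical degradedness: for every input distribution and every relay `T_{i+1}`, `i < K`,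
`(X_0, …, X_i) → (Y_{i+1}, X_{i+1}, …, X_K) → (Y_{i+2}, …, Y_{K+1})` is a Markov chain
(terminal numbering; the output of `T_{i+1}` has index `i` in the family `Y`). -/
def PhysicallyDegraded (W : (∀ j, X j) → PMF (∀ j, Y j)) : Prop :=
  ∀ (p : PMF (∀ j, X j)) (i : Fin K),
    IsMarkov (jointLaw W p)
      (fun ω => upTo i.castSucc ω.1)
      (fun ω => (ω.2 i.castSucc, after i.castSucc ω.1))
      (fun ω => after i.castSucc ω.2)

/-- `S_0 → S_1 → ⋯ → S_{K+1}` is a Markov chain: for every `i`, past and future are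
conditionally independent given `S_i`. -/
def DegradedSideInfo (q : PMF (∀ i, S i)) : Prop :=
  ∀ i : Fin (K + 2), IsMarkov q (fun s => before i s) (fun s => s i) (fun s => after i s)

/-- `I(X_0, …, X_j; Y | X_{j+1}, …, X_K)` where `Y` is the output of terminal `T_{j+1}`. -/
def cutInfo [∀ j, Fintype (X j)] [∀ j, Fintype (Y j)]
    (W : (∀ j, X j) → PMF (∀ j, Y j)) (p : PMF (∀ j, X j)) (j : Fin (K + 1)) : ℝ :=
  condMutualInfo (jointLaw W p)
    (fun ω => upTo j ω.1) (fun ω => ω.2 j) (fun ω => after j ω.1)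

/-- The quotient `a / h`, read as `∞` if `h = 0` (even if `a = 0`): a terminal that already
knows the source puts no constraint on the rate. -/
def ratio (a h : ℝ) : ℝ≥0∞ :=
  open scoped Classical in if h = 0 then ⊤ else ENNReal.ofReal (a / h)

end Network

end

end RelayNetwork

/-!
*Converse.* Fix a cut `j` and replace the channel by one which generates `Y_j` from the inputs
after `X_j` only. By physical degradedness the outputs from `Y_j` on, and by the Markov chain of
the sources the side information from `S_{j+1}` on, then say no more about `S_0` than `S_{j+1}`
does, so that a decoder can only guess. Changing the measure from this channel to the true one,
whose likelihood ratio is the exponential of the information density of the cut, and applying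
Jensen's inequality gives `m H(S_0 | S_{j+1}) ≤ n I_j + o(m)`. The input law in `I_j` is the time
average of the laws of the inputs, which is the same for all cuts.

*Achievability.* No degradedness is needed. Any input law is assembled from independent letters
`U_k`, where `X_k` is computed from `U_k, …, U_K`, without changing the information across the cuts.
In block `b + k` the terminal `T_k` represents the `b`-th source block by its letter. The later
terminals look for the only source block for which the conditional probability given their side
information, times the densities of the letters of all preceding terminals, received in successive
blocks, exceeds a threshold. By the chain rule these densities multiply to the density of the cut.
Moments of order `-l` with `l → 0+` bound the probability that the true block fails this test, a
union bound handles the other blocks, and the `K` extra blocks cost nothing in the limit of many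
blocks.
-/

namespace RelayNetwork

noncomputable section

section Probability

variable {Ω A B C : Type*}

lemma prob_nonneg (μ : PMF Ω) (f : Ω → A) (a : A) : 0 ≤ prob μ f a := ENNReal.toReal_nonneg

lemma prob_id (μ : PMF Ω) (ω : Ω) : prob μ id ω = (μ ω).toReal := by rw [prob, PMF.map_id]

lemma prob_eq_toOuterMeasure (μ : PMF Ω) (f : Ω → A) (a : A) :
    prob μ f a = (μ.toOuterMeasure (f ⁻¹' {a})).toReal := by
  rw [prob, ← PMF.toOuterMeasure_map_apply, PMF.toOuterMeasure_apply_singleton]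

lemma prob_le_of_preimage_subset (μ : PMF Ω) {f : Ω → A} {g : Ω → B} {a : A} {b : B}
    (h : f ⁻¹' {a} ⊆ g ⁻¹' {b}) : prob μ f a ≤ prob μ g b := by
  have hg : μ.toOuterMeasure (g ⁻¹' {b}) ≠ ∞ := by
    rw [← PMF.toOuterMeasure_map_apply, PMF.toOuterMeasure_apply_singleton]
    exact PMF.apply_ne_top _ b
  rw [prob_eq_toOuterMeasure, prob_eq_toOuterMeasure]
  exact ENNReal.toReal_mono hg (μ.toOuterMeasure.mono h)

lemma prob_eq_of_preimage_eq (μ : PMF Ω) {f : Ω → A} {g : Ω → B} {a : A} {b : B}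
    (h : f ⁻¹' {a} = g ⁻¹' {b}) : prob μ f a = prob μ g b := by
  rw [prob_eq_toOuterMeasure, prob_eq_toOuterMeasure, h]

lemma prob_le_prob_comp (μ : PMF Ω) (f : Ω → A) (φ : A → B) (a : A) :
    prob μ f a ≤ prob μ (fun ω => φ (f ω)) (φ a) :=
  prob_le_of_preimage_subset μ fun _ h => congrArg φ h

lemma prob_comp_of_injective (μ : PMF Ω) (f : Ω → A) {φ : A → B} (hφ : φ.Injective) (a : A) :
    prob μ (fun ω => φ (f ω)) (φ a) = prob μ f a :=
  (prob_le_of_preimage_subset μ fun _ h => hφ h).antisymm (prob_le_prob_comp μ f φ a)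

lemma toReal_le_prob (μ : PMF Ω) (f : Ω → A) (ω : Ω) : (μ ω).toReal ≤ prob μ f (f ω) := by
  rw [← prob_id]
  exact prob_le_prob_comp μ id f ω

lemma prob_pos (μ : PMF Ω) (f : Ω → A) {ω : Ω} (h : 0 < (μ ω).toReal) : 0 < prob μ f (f ω) :=
  h.trans_le (toReal_le_prob μ f ω)

lemma sum_toReal_eq_one [Fintype Ω] (μ : PMF Ω) : ∑ ω, (μ ω).toReal = 1 := by
  rw [← ENNReal.toReal_sum fun ω _ => μ.apply_ne_top ω, ← tsum_fintype (L := .unconditional _),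
    μ.tsum_coe, ENNReal.toReal_one]

lemma sum_prob [Fintype A] (μ : PMF Ω) (f : Ω → A) : ∑ a, prob μ f a = 1 :=
  sum_toReal_eq_one (μ.map f)

lemma prob_eq_sum [Fintype Ω] [DecidableEq A] (μ : PMF Ω) (f : Ω → A) (a : A) :
    prob μ f a = ∑ ω with f ω = a, (μ ω).toReal := by
  rw [prob, PMF.map_apply, tsum_fintype, ENNReal.toReal_sum, Finset.sum_filter]
  · refine Finset.sum_congr rfl fun ω _ => ?_
    split_ifs <;> simp_all
  · intro ω _
    split_ifs
    exacts [μ.apply_ne_top ω, ENNReal.zero_ne_top]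

lemma prob_comp_eq_sum [Fintype A] [DecidableEq B] (μ : PMF Ω) (f : Ω → A) (φ : A → B) (b : B) :
    prob μ (fun ω => φ (f ω)) b = ∑ a with φ a = b, prob μ f a := by
  have h := prob_eq_sum (μ.map f) φ b
  rwa [prob, PMF.map_comp] at h

lemma sum_prob_pair [Fintype A] [Finite B] (μ : PMF Ω) (f : Ω → A) (g : Ω → B) (b : B) :
    ∑ a, prob μ (fun ω => (f ω, g ω)) (a, b) = prob μ g b := by
  classical
  have := Fintype.ofFinite B
  rw [prob_comp_eq_sum μ (fun ω => (f ω, g ω)) Prod.snd b, Finset.sum_filter,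
    Fintype.sum_prod_type]
  simp

lemma sum_prob_mul [Fintype Ω] [Fintype A] (μ : PMF Ω) (f : Ω → A) (F : A → ℝ) :
    ∑ a, prob μ f a * F a = ∑ ω, (μ ω).toReal * F (f ω) := by
  classical
  simp only [prob_eq_sum, Finset.sum_filter, Finset.sum_mul, ite_mul, zero_mul]
  rw [Finset.sum_comm]
  simp

lemma exists_pmf_toReal_eq [Fintype Ω] {w : Ω → ℝ} (hw : ∀ ω, 0 ≤ w ω) (hw₁ : ∑ ω, w ω = 1) :
    ∃ μ : PMF Ω, ∀ ω, (μ ω).toReal = w ω := by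
  refine ⟨PMF.ofFintype (fun ω => ENNReal.ofReal (w ω)) ?_, fun ω => ?_⟩
  · rw [← ENNReal.ofReal_sum_of_nonneg fun ω _ => hw ω, hw₁, ENNReal.ofReal_one]
  · rw [PMF.ofFintype_apply, ENNReal.toReal_ofReal (hw ω)]

lemma exists_pmf_mul_prob_eq [Finite A] [Finite B] (μ : PMF Ω) (f : Ω → A) (g : Ω → B) :
    ∃ κ : B → PMF A, ∀ b a, (κ b a).toReal * prob μ g b = prob μ (fun ω => (f ω, g ω)) (a, b) := by
  have := Fintype.ofFinite A
  suffices h : ∀ b, ∃ κ : PMF A, ∀ a, (κ a).toReal * prob μ g b =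
      prob μ (fun ω => (f ω, g ω)) (a, b) from ⟨_, fun b => (h b).choose_spec⟩
  intro b
  rcases eq_or_ne (prob μ g b) 0 with hb | hb
  · refine ⟨μ.map f, fun a => ?_⟩
    rw [hb, mul_zero]
    exact (prob_nonneg _ _ _).antisymm
      ((prob_le_prob_comp μ (fun ω => (f ω, g ω)) Prod.snd (a, b)).trans_eq hb)
  · obtain ⟨κ, hκ⟩ := exists_pmf_toReal_eq (w := fun a =>
      prob μ (fun ω => (f ω, g ω)) (a, b) / prob μ g b)
      (fun a => div_nonneg (prob_nonneg _ _ _) (prob_nonneg _ _ _))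
      (by rw [← Finset.sum_div, sum_prob_pair, div_self hb])
    exact ⟨κ, fun a => by rw [hκ, div_mul_cancel₀ _ hb]⟩

lemma toReal_bind_map_mk_apply (μ : PMF A) (κ : A → PMF B) (a : A) (b : B) :
    (μ.bind (fun a => (κ a).map (Prod.mk a)) (a, b)).toReal = (μ a).toReal * (κ a b).toReal := by
  rw [← ENNReal.toReal_mul, PMF.bind_apply, tsum_eq_single a]
  · rw [PMF.map_apply, tsum_eq_single b, if_pos rfl]
    exact fun b' hb => if_neg fun h => hb (Prod.mk.inj h).2.symm
  · intro a' ha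
    rw [PMF.map_apply, ENNReal.tsum_eq_zero.2 fun b' => ?_, mul_zero]
    exact if_neg fun h => ha (Prod.mk.inj h).1.symm

lemma nonempty_of_pmf (μ : PMF Ω) : Nonempty Ω :=
  μ.support_nonempty.to_type

end Probability

section Product

variable {I : Type*} [Fintype I] [DecidableEq I] {α : I → Type*} [∀ i, Fintype (α i)]
  (μ : ∀ i, PMF (α i))

/-- The law of a family of independent random variables with laws `μ i`. -/
def piPMF : PMF (∀ i, α i) :=
  PMF.ofFintype (fun ω => ∏ i, μ i (ω i)) <| by
    rw [← Fintype.prod_sum fun i a => μ i a]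
    exact Finset.prod_eq_one fun i _ => (tsum_fintype _).symm.trans (μ i).tsum_coe

lemma toReal_piPMF_apply (ω : ∀ i, α i) : (piPMF μ ω).toReal = ∏ i, (μ i (ω i)).toReal :=
  ENNReal.toReal_prod _ _

variable {μ} in
lemma toReal_pos_of_piPMF_pos {ω : ∀ i, α i} (h : 0 < (piPMF μ ω).toReal) (i : I) :
    0 < (μ i (ω i)).toReal := by
  rw [toReal_piPMF_apply] at h
  exact ENNReal.toReal_nonneg.lt_of_ne' (Finset.prod_ne_zero_iff.1 h.ne' i (Finset.mem_univ i))

lemma sum_piPMF_mul_prod (F : ∀ i, α i → ℝ) :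
    ∑ ω, (piPMF μ ω).toReal * ∏ i, F i (ω i) = ∏ i, ∑ a, (μ i a).toReal * F i a := by
  rw [Fintype.prod_sum]
  simp only [toReal_piPMF_apply, Finset.prod_mul_distrib]

lemma prob_piPMF_eq_prod {B : Type*} {f : (∀ i, α i) → B} {b : B} {t : ∀ i, α i → Prop}
    [∀ i, DecidablePred (t i)] (h : ∀ ω, f ω = b ↔ ∀ i, t i (ω i)) :
    prob (piPMF μ) f b = ∏ i, ∑ a with t i a, (μ i a).toReal := by
  classical
  have hprod := sum_piPMF_mul_prod μ fun i a => if t i a then 1 else 0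
  simp only [Finset.prod_boole, Finset.mem_univ, true_imp_iff, ← h, mul_boole,
    ← Finset.sum_filter] at hprod
  rw [prob_eq_sum, hprod]

lemma sum_piPMF_mul_sum_update (i : I) (F : (∀ i, α i) → ℝ) :
    ∑ ω, (piPMF μ ω).toReal * ∑ a, (μ i a).toReal * F (Function.update ω i a) =
      ∑ ω, (piPMF μ ω).toReal * F ω := by
  let swap (z : (∀ i, α i) × α i) : (∀ i, α i) × α i := (Function.update z.1 i z.2, z.1 i)
  have hswap : swap.Involutive := fun z => by simp [swap]
  have hweight (z) : (piPMF μ (swap z).1).toReal * (μ i (swap z).2).toReal =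
      (piPMF μ z.1).toReal * (μ i z.2).toReal := by
    simp only [swap, toReal_piPMF_apply, ← Finset.mul_prod_erase _ _ (Finset.mem_univ i),
      Function.update_self]
    rw [Finset.prod_congr rfl fun k hk => by
      rw [Function.update_of_ne (Finset.ne_of_mem_erase hk)]]
    ring
  calc _ = ∑ z, (piPMF μ (swap z).1).toReal * (μ i (swap z).2).toReal * F (swap z).1 := by
        simp only [hweight, Fintype.sum_prod_type, Finset.mul_sum, mul_assoc, swap]
    _ = ∑ z : (∀ i, α i) × α i, (piPMF μ z.1).toReal * (μ i z.2).toReal * F z.1 :=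
        Equiv.sum_comp (hswap.toPerm swap) fun z => (piPMF μ z.1).toReal * (μ i z.2).toReal * F z.1
    _ = _ := by
        simp only [Fintype.sum_prod_type, ← Finset.sum_mul, ← Finset.mul_sum, sum_toReal_eq_one,
          mul_one]

lemma map_piPMF_comp {J : Type*} [Fintype J] [DecidableEq J] {e : J → I} (he : e.Injective) :
    (piPMF μ).map (fun ω j => ω (e j)) = piPMF fun j => μ (e j) := by
  classical
  ext h
  let t (i : I) : Finset (α i) := {a | ∀ j, e j = i → HEq (h j) a}
  have ht : ({ω | h = fun j => ω (e j)} : Finset (∀ i, α i)) = Fintype.piFinset t := by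
    ext ω
    simp only [Finset.mem_filter, Finset.mem_univ, true_and, Fintype.mem_piFinset, t]
    exact ⟨by rintro rfl i j rfl; rfl, fun hω => funext fun j => eq_of_heq (hω _ j rfl)⟩
  have hsum : (piPMF μ).map (fun ω j => ω (e j)) h = ∑ ω ∈ Fintype.piFinset t, ∏ i, μ i (ω i) := by
    rw [PMF.map_apply, tsum_fintype, ← ht, Finset.sum_filter]
    exact Finset.sum_congr rfl fun ω _ => by congr
  refine (hsum.trans (Finset.prod_univ_sum t fun i a => μ i a).symm).trans ?_
  refine (Fintype.prod_of_injective e he _ _ (fun i hi => ?_) fun j => ?_).symm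
  · have : t i = Finset.univ := Finset.filter_true_of_mem fun a _ j hj => absurd ⟨j, hj⟩ hi
    rw [this, ← tsum_fintype (L := .unconditional _), (μ i).tsum_coe]
  · have : t (e j) = {h j} := by
      ext a
      simp only [t, Finset.mem_filter, Finset.mem_univ, true_and, Finset.mem_singleton]
      refine ⟨fun ha => (eq_of_heq (ha j rfl)).symm, ?_⟩
      rintro rfl j' hj'
      rw [he hj']
    rw [this, Finset.sum_singleton]

lemma map_piPMF_apply (i : I) : (piPMF μ).map (fun ω => ω i) = μ i := by
  have h := congrArg (PMF.map fun h : Unit → α i => h ()) <|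
    map_piPMF_comp μ (e := fun _ : Unit => i) fun _ _ _ => rfl
  rw [PMF.map_comp] at h
  refine h.trans (PMF.ext fun a => ?_)
  rw [PMF.map_apply, tsum_eq_single fun _ => a]
  · simp [piPMF]
  · exact fun b hb => if_neg fun hab => hb (funext fun _ => hab.symm)

lemma sum_piPMF_mul_comp {J : Type*} [Fintype J] [DecidableEq J] {e : J → I} (he : e.Injective)
    (F : (∀ j, α (e j)) → ℝ) : ∑ ω, (piPMF μ ω).toReal * F (fun j => ω (e j)) =
      ∑ h, (piPMF (fun j => μ (e j)) h).toReal * F h := by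
  rw [← map_piPMF_comp μ he]
  exact (sum_prob_mul (piPMF μ) (fun ω j => ω (e j)) F).symm

lemma sum_piPMF_mul_apply (i : I) (F : α i → ℝ) :
    ∑ ω, (piPMF μ ω).toReal * F (ω i) = ∑ a, (μ i a).toReal * F a := by
  simp only [← sum_prob_mul (piPMF μ) (fun ω => ω i) F, prob, map_piPMF_apply]

end Product

section CondProb

variable {Ω A B C : Type*}

/-- The conditional probability `Pr{f = a | g = b}` under `μ`; it is `0` if `Pr{g = b} = 0`. -/
def condProb (μ : PMF Ω) (f : Ω → A) (g : Ω → B) (a : A) (b : B) : ℝ :=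
  prob μ (fun ω => (f ω, g ω)) (a, b) / prob μ g b

variable (μ : PMF Ω) (f : Ω → A) (g : Ω → B) (h : Ω → C)

lemma condProb_nonneg (a : A) (b : B) : 0 ≤ condProb μ f g a b :=
  div_nonneg (prob_nonneg _ _ _) (prob_nonneg _ _ _)

lemma condProb_le_one (a : A) (b : B) : condProb μ f g a b ≤ 1 :=
  div_le_one_of_le₀ (prob_le_prob_comp μ (fun ω => (f ω, g ω)) Prod.snd (a, b)) (prob_nonneg _ _ _)

lemma condProb_pos {ω : Ω} (hω : 0 < (μ ω).toReal) : 0 < condProb μ f g (f ω) (g ω) :=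
  div_pos (prob_pos μ (fun ω => (f ω, g ω)) hω) (prob_pos μ g hω)

lemma condProb_mul_prob (a : A) (b : B) :
    condProb μ f g a b * prob μ g b = prob μ (fun ω => (f ω, g ω)) (a, b) :=
  div_mul_cancel_of_imp fun hb =>
    ((prob_le_prob_comp μ (fun ω => (f ω, g ω)) Prod.snd (a, b)).trans_eq hb).antisymm
      (prob_nonneg _ _ _)

lemma sum_condProb_le_one [Fintype A] [Finite B] (b : B) : ∑ a, condProb μ f g a b ≤ 1 := by
  simp only [condProb, ← Finset.sum_div, sum_prob_pair]
  exact div_self_le_one _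

lemma condProb_pair (a : A) (b : B) (c : C) :
    condProb μ (fun ω => (f ω, g ω)) h (a, b) c =
      condProb μ f (fun ω => (g ω, h ω)) a (b, c) * condProb μ g h b c := by
  have hassoc : prob μ (fun ω => ((f ω, g ω), h ω)) ((a, b), c) =
      prob μ (fun ω => (f ω, g ω, h ω)) (a, b, c) :=
    (prob_comp_of_injective μ _ (Equiv.prodAssoc A B C).injective ((a, b), c)).symm
  rw [condProb, hassoc, ← condProb_mul_prob μ f (fun ω => (g ω, h ω)), mul_div_assoc]
  rfl

lemma condProb_swap (a : A) (b : B) (c : C) :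
    condProb μ (fun ω => (g ω, f ω)) h (b, a) c = condProb μ (fun ω => (f ω, g ω)) h (a, b) c :=
  congrArg (· / _) (prob_comp_of_injective μ (fun ω => ((f ω, g ω), h ω))
    (Prod.swap_injective.prodMap Function.injective_id) ((a, b), c))

lemma condProb_pair' (a : A) (b : B) (c : C) :
    condProb μ (fun ω => (f ω, g ω)) h (a, b) c =
      condProb μ g (fun ω => (f ω, h ω)) b (a, c) * condProb μ f h a c := by
  rw [← condProb_swap, condProb_pair]

lemma condProb_congr_right {b : B} {c : C} (hgh : g ⁻¹' {b} = h ⁻¹' {c}) (a : A) :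
    condProb μ f g a b = condProb μ f h a c := by
  refine congrArg₂ (· / ·) (prob_eq_of_preimage_eq μ ?_) (prob_eq_of_preimage_eq μ hgh)
  simp only [← Set.singleton_prod_singleton, Set.mk_preimage_prod, hgh]

lemma condProb_comp_of_injective {φ : B → C} (hφ : φ.Injective) (a : A) (b : B) :
    condProb μ f (fun ω => φ (g ω)) a (φ b) = condProb μ f g a b :=
  condProb_congr_right μ f _ g (Set.ext fun _ => hφ.eq_iff) a

variable [Fintype A] [Fintype B]

lemma condEntropy_nonneg : 0 ≤ condEntropy μ f g :=
  neg_nonneg.2 <| Finset.sum_nonpos fun _ _ => Finset.sum_nonpos fun _ _ =>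
    mul_nonpos_of_nonneg_of_nonpos (prob_nonneg _ _ _) <|
      Real.log_nonpos (condProb_nonneg _ _ _ _ _) (condProb_le_one _ _ _ _ _)

variable [Fintype Ω]

lemma condEntropy_eq_sum : condEntropy μ f g =
    ∑ ω, (μ ω).toReal * -Real.log (condProb μ f g (f ω) (g ω)) := by
  have hsum := sum_prob_mul μ (fun ω => (f ω, g ω)) fun ab => Real.log (condProb μ f g ab.1 ab.2)
  simp only [mul_neg, Finset.sum_neg_distrib, ← hsum, Fintype.sum_prod_type]
  rfl

lemma condMutualInfo_eq_sum [Fintype C] : condMutualInfo μ f g h =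
    ∑ ω, (μ ω).toReal * Real.log (condProb μ g (fun ω => (f ω, h ω)) (g ω) (f ω, h ω) /
      condProb μ g h (g ω) (h ω)) := by
  rw [condMutualInfo, condEntropy_eq_sum, condEntropy_eq_sum, ← Finset.sum_sub_distrib]
  refine Finset.sum_congr rfl fun ω _ => ?_
  rcases ENNReal.toReal_nonneg (a := μ ω) |>.eq_or_lt with hω | hω
  · simp [← hω]
  have hf := condProb_pos μ f h hω
  have hg := condProb_pos μ g h hω
  have hf' := condProb_pos μ f (fun ω => (g ω, h ω)) hω
  rw [← mul_sub, neg_sub_neg, ← Real.log_div hf'.ne' hf.ne']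
  congr 2
  rw [div_eq_div_iff hf.ne' hg.ne', ← condProb_pair, ← condProb_pair, condProb_swap]

end CondProb

section Markov

variable {Ω A B C D : Type*} {μ : PMF Ω} {f : Ω → A} {g : Ω → B} {h : Ω → C}

lemma IsMarkov.prob_eq_mul_condProb (hM : IsMarkov μ f g h) (a : A) (b : B) (c : C) :
    prob μ (fun ω => (f ω, g ω, h ω)) (a, b, c) =
      condProb μ f g a b * prob μ (fun ω => (g ω, h ω)) (b, c) := by
  have hle := prob_le_prob_comp μ (fun ω => (f ω, g ω, h ω)) (fun z => z.2.1) (a, b, c)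
  rcases eq_or_ne (prob μ g b) 0 with hb | hb
  · rw [condProb, hb, div_zero, zero_mul]
    exact (hle.trans_eq hb).antisymm (prob_nonneg _ _ _)
  · rw [condProb, div_mul_eq_mul_div, eq_div_iff hb]
    exact hM a b c

lemma IsMarkov.comp_left [Finite A] [Finite B] [Finite C] (hM : IsMarkov μ f g h) (φ : A → D) :
    IsMarkov μ (fun ω => φ (f ω)) g h := by
  classical
  have := Fintype.ofFinite A
  have := Fintype.ofFinite B
  have := Fintype.ofFinite C
  intro d b c
  have h₃ := prob_comp_eq_sum μ (fun ω => (f ω, g ω, h ω)) (Prod.map φ id) (d, b, c)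
  have h₂ := prob_comp_eq_sum μ (fun ω => (f ω, g ω)) (Prod.map φ id) (d, b)
  simp only [id, Finset.sum_filter, Fintype.sum_prod_type, Prod.map,
    Prod.mk.injEq, ite_and, Finset.sum_ite_irrel, Finset.sum_ite_eq', Finset.mem_univ, if_true,
    Finset.sum_const_zero] at h₃ h₂
  rw [h₃, h₂, Finset.sum_mul, Finset.sum_mul]
  refine Finset.sum_congr rfl fun a _ => ?_
  split_ifs
  exacts [hM a b c, by simp]

lemma isMarkov_of_subsingleton [Subsingleton C] : IsMarkov μ f g h := by
  intro a b c
  have hc (ω : Ω) : h ω = c := Subsingleton.elim _ _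
  simp only [hc]
  rw [prob_comp_of_injective μ g (Prod.mk_left_injective c),
    ← prob_comp_of_injective μ (fun ω => (f ω, g ω)) (φ := fun z => (z.1, z.2, c))
      (fun z z' hz => by simp_all [Prod.ext_iff]) (a, b)]

lemma IsMarkov.condProb_eq (hM : IsMarkov μ f g h) {a : A} {b : B} (c : C)
    (hab : prob μ (fun ω => (f ω, g ω)) (a, b) ≠ 0) :
    condProb μ h (fun ω => (f ω, g ω)) c (a, b) = condProb μ h g c b := by
  have hb : prob μ g b ≠ 0 := fun hb => hab <|
    ((prob_le_prob_comp μ (fun ω => (f ω, g ω)) Prod.snd (a, b)).trans_eq hb).antisymm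
      (prob_nonneg _ _ _)
  have h₃ : prob μ (fun ω => (h ω, f ω, g ω)) (c, a, b) =
      prob μ (fun ω => (f ω, g ω, h ω)) (a, b, c) :=
    prob_comp_of_injective μ (fun ω => (f ω, g ω, h ω)) (φ := fun z => (z.2.2, z.1, z.2.1))
      (fun z z' hz => by simp_all [Prod.ext_iff]) (a, b, c)
  have h₂ : prob μ (fun ω => (h ω, g ω)) (c, b) = prob μ (fun ω => (g ω, h ω)) (b, c) :=
    prob_comp_of_injective μ (fun ω => (g ω, h ω)) Prod.swap_injective (b, c)
  rw [condProb, condProb, h₃, h₂, div_eq_div_iff hab hb, hM a b c, mul_comm]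

end Markov

section Causal

variable {𝒳 𝒴 𝒵 𝒱 : Type*} {n : ℕ}

/-- A system of inputs with causal feedback: `x y t`, the input at time `t` when the outputs
are `y`, depends only on the outputs before time `t`. -/
def Causal (x : (Fin n → 𝒴) → Fin n → 𝒳) : Prop :=
  ∀ t, DependsOn (fun y => x y t) (Set.Iio t)

/-- The inputs that remain after a first output `b`. -/
def residual (x : (Fin (n + 1) → 𝒴) → Fin (n + 1) → 𝒳) (b : 𝒴) : (Fin n → 𝒴) → Fin n → 𝒳 :=
  fun y t => x (Fin.cons b y) t.succ

/-- The probability of the outputs `y` when the inputs are `x` and each output is drawn from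
the kernel `Q`, which need not be normalized. -/
def feedbackLaw (Q : 𝒳 → 𝒴 → ℝ) (x : (Fin n → 𝒴) → Fin n → 𝒳) (y : Fin n → 𝒴) : ℝ :=
  ∏ t, Q (x y t) (y t)

lemma Causal.residual {x : (Fin (n + 1) → 𝒴) → Fin (n + 1) → 𝒳} (hx : Causal x) (b : 𝒴) :
    Causal (residual x b) := by
  refine fun t y y' h => hx _ fun u hu => ?_
  induction u using Fin.cases with
  | zero => rfl
  | succ u => exact h u (Fin.succ_lt_succ_iff.1 hu)

lemma Causal.apply_zero_eq {x : (Fin (n + 1) → 𝒴) → Fin (n + 1) → 𝒳} (hx : Causal x)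
    (y y' : Fin (n + 1) → 𝒴) : x y 0 = x y' 0 :=
  hx 0 fun u hu => absurd hu (Fin.not_lt_zero u)

lemma feedbackLaw_nonneg {Q : 𝒳 → 𝒴 → ℝ} (hQ : ∀ x y, 0 ≤ Q x y)
    (x : (Fin n → 𝒴) → Fin n → 𝒳) (y : Fin n → 𝒴) : 0 ≤ feedbackLaw Q x y :=
  Finset.prod_nonneg fun _ _ => hQ _ _

lemma Causal.sum_feedbackLaw_mul [Fintype 𝒴] {x : (Fin (n + 1) → 𝒴) → Fin (n + 1) → 𝒳}
    (hx : Causal x) (Q : 𝒳 → 𝒴 → ℝ) (y₀ : Fin (n + 1) → 𝒴) (F : (Fin (n + 1) → 𝒴) → ℝ) :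
    ∑ y, feedbackLaw Q x y * F y = ∑ b, Q (x y₀ 0) b *
      ∑ y, feedbackLaw Q (RelayNetwork.residual x b) y * F (Fin.cons b y) := by
  rw [← (Fin.consEquiv fun _ => 𝒴).sum_comp, Fintype.sum_prod_type]
  refine Finset.sum_congr rfl fun b _ => ?_
  rw [Finset.mul_sum]
  refine Finset.sum_congr rfl fun y _ => ?_
  rw [← mul_assoc, feedbackLaw, Fin.prod_univ_succ, hx.apply_zero_eq _ y₀]
  rfl

lemma sum_feedbackLaw_comp_le [Fintype 𝒴] [DecidableEq 𝒵] [Fintype 𝒵] {Q : 𝒳 → 𝒴 → ℝ}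
    {U : 𝒱 → 𝒵 → ℝ} {ρ : 𝒳 → 𝒱} {π : 𝒴 → 𝒵} (hQ : ∀ x y, 0 ≤ Q x y) (hU : ∀ v z, 0 ≤ U v z)
    (hQU : ∀ x z, ∑ y with π y = z, Q x y ≤ U (ρ x) z)
    {x : (Fin n → 𝒴) → Fin n → 𝒳} {v : (Fin n → 𝒵) → Fin n → 𝒱} (hx : Causal x) (hv : Causal v)
    (hxv : ∀ y t, ρ (x y t) = v (π ∘ y) t) {F : (Fin n → 𝒵) → ℝ} (hF : ∀ z, 0 ≤ F z) :
    ∑ y, feedbackLaw Q x y * F (π ∘ y) ≤ ∑ z, feedbackLaw U v z * F z := by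
  induction n with
  | zero => simp [feedbackLaw, Subsingleton.elim (π ∘ (default : Fin 0 → 𝒴)) default]
  | succ n ih =>
    rcases isEmpty_or_nonempty 𝒴 with _ | ⟨⟨y₀⟩⟩
    · rw [Fintype.sum_empty]
      exact Finset.sum_nonneg fun z _ => mul_nonneg (feedbackLaw_nonneg hU v z) (hF z)
    set G : 𝒵 → ℝ := fun c => ∑ z, feedbackLaw U (residual v c) z * F (Fin.cons c z)
    have hG₀ (c : 𝒵) : 0 ≤ G c :=
      Finset.sum_nonneg fun z _ => mul_nonneg (feedbackLaw_nonneg hU _ z) (hF _)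
    have hcons (b : 𝒴) (y : Fin n → 𝒴) : π ∘ (Fin.cons b y : Fin (n + 1) → 𝒴) =
        Fin.cons (π b) (π ∘ y) := by
      funext u
      induction u using Fin.cases <;> rfl
    have htail (b : 𝒴) :
        ∑ y, feedbackLaw Q (residual x b) y * F (π ∘ Fin.cons b y) ≤ G (π b) := by
      simp only [hcons]
      refine ih (hx.residual b) (hv.residual (π b)) (fun y t => ?_) (fun _ => hF _)
      rw [residual, hxv, hcons, residual]
    rw [hx.sum_feedbackLaw_mul Q fun _ => y₀, hv.sum_feedbackLaw_mul U (π ∘ fun _ => y₀)]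
    calc _ ≤ ∑ b, Q (x (fun _ => y₀) 0) b * G (π b) :=
          Finset.sum_le_sum fun b _ => mul_le_mul_of_nonneg_left (htail b) (hQ _ b)
      _ = ∑ c, (∑ b with π b = c, Q (x (fun _ => y₀) 0) b) * G c := by
          rw [← Finset.sum_fiberwise _ π]
          refine Finset.sum_congr rfl fun c _ => ?_
          rw [Finset.sum_mul]
          exact Finset.sum_congr rfl fun b hb => by rw [(Finset.mem_filter.1 hb).2]
      _ ≤ _ := Finset.sum_le_sum fun c _ =>
          mul_le_mul_of_nonneg_right ((hQU _ c).trans_eq (by rw [hxv])) (hG₀ c)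

lemma sum_feedbackLaw_le_one [Fintype 𝒴] {Q : 𝒳 → 𝒴 → ℝ} (hQ : ∀ x y, 0 ≤ Q x y)
    (hQ₁ : ∀ x, ∑ y, Q x y ≤ 1) {x : (Fin n → 𝒴) → Fin n → 𝒳} (hx : Causal x) :
    ∑ y, feedbackLaw Q x y ≤ 1 := by
  have h := sum_feedbackLaw_comp_le (U := fun _ _ => 1) (ρ := fun _ => ()) (π := fun _ => ())
    (v := fun _ _ => ()) (F := fun _ => 1) hQ (fun _ _ => zero_le_one)
    (fun x _ => by simpa using hQ₁ x) hx (fun _ _ _ _ => rfl) (fun _ _ => rfl)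
    (fun _ => zero_le_one)
  simpa [feedbackLaw] using h

lemma sum_feedbackLaw_eq_one [Fintype 𝒴] [Nonempty 𝒴] {Q : 𝒳 → 𝒴 → ℝ}
    (hQ₁ : ∀ x, ∑ y, Q x y = 1) {x : (Fin n → 𝒴) → Fin n → 𝒳} (hx : Causal x) :
    ∑ y, feedbackLaw Q x y = 1 := by
  induction n with
  | zero => simp [feedbackLaw]
  | succ n ih =>
    have h := hx.sum_feedbackLaw_mul Q (fun _ => Classical.arbitrary 𝒴) fun _ => 1
    simpa [ih (hx.residual _), hQ₁] using h

lemma sum_feedbackLaw_mul_eq_sum_expect [Fintype 𝒴] {Q : 𝒳 → 𝒴 → ℝ} (hQ₁ : ∀ x, ∑ y, Q x y = 1)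
    {x : (Fin n → 𝒴) → Fin n → 𝒳} (hx : Causal x) (h : 𝒳 → 𝒴 → ℝ) (t : Fin n) :
    ∑ y, feedbackLaw Q x y * h (x y t) (y t) =
      ∑ y, feedbackLaw Q x y * ∑ b, Q (x y t) b * h (x y t) b := by
  rcases isEmpty_or_nonempty 𝒴 with _ | ⟨⟨y₀⟩⟩
  · have : IsEmpty (Fin n → 𝒴) := ⟨fun y => isEmptyElim (y t)⟩
    simp
  induction n with
  | zero => exact t.elim0
  | succ n ih =>
    have : Nonempty 𝒴 := ⟨y₀⟩
    simp only [hx.sum_feedbackLaw_mul Q fun _ => y₀]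
    induction t using Fin.cases with
    | zero =>
      simp only [hx.apply_zero_eq (Fin.cons _ _) fun _ => y₀, Fin.cons_zero, ← Finset.sum_mul,
        sum_feedbackLaw_eq_one hQ₁ (hx.residual _), one_mul, hQ₁]
    | succ t => exact Finset.sum_congr rfl fun b _ => congrArg _ (ih (hx.residual b) t)

end Causal

section Tuples

variable {N : ℕ} {Z : Fin N → Type*} {j : Fin N}

lemma upTo_after_injective (j : Fin N) :
    Function.Injective fun z : ∀ k, Z k => (upTo j z, after j z) := by
  intro z z' h
  rw [Prod.mk.injEq] at h
  funext k
  rcases le_or_gt k j with hk | hk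
  exacts [congrFun h.1 ⟨k, hk⟩, congrFun h.2 ⟨k, hk⟩]

/-- Entries `j, j + 1, …` of a tuple, with entry `j` kept apart from the later ones. -/
def tailFrom (j : Fin N) (z : ∀ k, Z k) : Z j × (∀ k : {k // j < k}, Z k) :=
  (z j, after j z)

lemma eq_of_tailFrom_eq {z z' : ∀ k, Z k} (h : tailFrom j z = tailFrom j z') {k : Fin N}
    (hk : j ≤ k) : z k = z' k := by
  rw [tailFrom, tailFrom, Prod.mk.injEq] at h
  rcases hk.eq_or_lt with rfl | hk
  exacts [h.1, congrFun h.2 ⟨k, hk⟩]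

lemma tailFrom_surjective [Nonempty (∀ k, Z k)] (j : Fin N) :
    Function.Surjective (tailFrom j : (∀ k, Z k) → _) := by
  rintro ⟨b, w⟩
  let z₀ : ∀ k, Z k := Classical.arbitrary _
  refine ⟨fun k => if h : j < k then w ⟨k, h⟩ else Function.update z₀ j b k, ?_⟩
  refine Prod.ext (by simp [tailFrom]) (funext fun k => ?_)
  simp [tailFrom, after, k.2]

end Tuples

section JointLaw

variable {K : ℕ} {X Y : Fin (K + 1) → Type*} (W : (∀ j, X j) → PMF (∀ j, Y j))
  (p : PMF (∀ j, X j))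

lemma toReal_jointLaw_apply (x : ∀ j, X j) (y : ∀ j, Y j) :
    (jointLaw W p (x, y)).toReal = (p x).toReal * (W x y).toReal :=
  toReal_bind_map_mk_apply p W x y

lemma prob_jointLaw_comp_fst {A : Type*} (f : (∀ j, X j) → A) (a : A) :
    prob (jointLaw W p) (fun ω => f ω.1) a = prob p f a := by
  have hconst (x : ∀ j, X j) : (W x).map (fun _ => f x) = PMF.pure (f x) := PMF.map_const _ _
  rw [prob, jointLaw, PMF.map_bind]
  simp only [PMF.map_comp, Function.comp_def, hconst]
  rfl

lemma condProb_jointLaw_fst [∀ j, Finite (X j)] [∀ j, Finite (Y j)] {A : Type*}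
    (g : (∀ j, Y j) → A) (a : A) {x : ∀ j, X j} (hx : (p x).toReal ≠ 0) :
    condProb (jointLaw W p) (fun ω => g ω.2) Prod.fst a x = prob (W x) g a := by
  classical
  have := fun j => Fintype.ofFinite (X j)
  have := fun j => Fintype.ofFinite (Y j)
  have hfst : prob (jointLaw W p) Prod.fst x = (p x).toReal :=
    (prob_jointLaw_comp_fst W p id x).trans (prob_id p x)
  rw [condProb, hfst, div_eq_iff hx, prob_eq_sum, prob_eq_sum, Finset.sum_filter,
    Fintype.sum_prod_type, Finset.sum_eq_single x, Finset.sum_filter, Finset.sum_mul]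
  · simp [toReal_jointLaw_apply, mul_comm]
  · exact fun x' _ hx' => Finset.sum_eq_zero fun y _ => if_neg fun h => hx' (Prod.mk.inj h).2
  · simp

end JointLaw

section Cut

variable {K : ℕ} {X Y : Fin (K + 1) → Type*} (W : (∀ j, X j) → PMF (∀ j, Y j))
  (p : PMF (∀ j, X j)) (j : Fin (K + 1))

/-- The channel in which the output `Y_j` is generated from the inputs after `X_j` only, while
the other outputs are generated from `Y_j` and all inputs as in `W`. Its rows sum to at most `1`,
and vanish at the inputs of probability `0`. -/
def cutKernel (x : ∀ j, X j) (y : ∀ j, Y j) : ℝ :=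
  (W x y).toReal *
    (condProb (jointLaw W p) (fun ω => ω.2 j) (fun ω => after j ω.1) (y j) (after j x) /
      condProb (jointLaw W p) (fun ω => ω.2 j) Prod.fst (y j) x)

/-- The information density of the cut `j`: its mean is `cutInfo W p j`. -/
def cutDensity (ω : (∀ j, X j) × (∀ j, Y j)) : ℝ :=
  Real.log (condProb (jointLaw W p) (fun ω => ω.2 j) Prod.fst (ω.2 j) ω.1 /
    condProb (jointLaw W p) (fun ω => ω.2 j) (fun ω => after j ω.1) (ω.2 j) (after j ω.1))

lemma cutInfo_eq_sum [∀ j, Fintype (X j)] [∀ j, Fintype (Y j)] :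
    cutInfo W p j = ∑ ω, (jointLaw W p ω).toReal * cutDensity W p j ω := by
  rw [cutInfo, condMutualInfo_eq_sum]
  refine Finset.sum_congr rfl fun ω _ => ?_
  rw [cutDensity, ← condProb_comp_of_injective _ _ Prod.fst (upTo_after_injective j)]

lemma cutKernel_nonneg (x : ∀ j, X j) (y : ∀ j, Y j) : 0 ≤ cutKernel W p j x y :=
  mul_nonneg ENNReal.toReal_nonneg (div_nonneg (condProb_nonneg _ _ _ _ _)
    (condProb_nonneg _ _ _ _ _))

variable {W} in
lemma cutKernel_eq {x : ∀ j, X j} {y : ∀ j, Y j} (h : 0 < (jointLaw W p (x, y)).toReal) :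
    cutKernel W p j x y = (W x y).toReal * Real.exp (-cutDensity W p j (x, y)) := by
  have h₁ := condProb_pos (jointLaw W p) (fun ω => ω.2 j) Prod.fst h
  have h₂ := condProb_pos (jointLaw W p) (fun ω => ω.2 j) (fun ω => after j ω.1) h
  rw [cutDensity, Real.exp_neg, Real.exp_log (div_pos h₁ h₂), inv_div, cutKernel]

variable {W} in
lemma PhysicallyDegraded.isMarkov (hW : PhysicallyDegraded W) :
    IsMarkov (jointLaw W p) (fun ω => upTo j ω.1) (fun ω => (ω.2 j, after j ω.1))
      (fun ω => after j ω.2) := by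
  induction j using Fin.lastCases with
  | last =>
    have : IsEmpty {k // Fin.last K < k} := ⟨fun k => (Fin.le_last k.1).not_gt k.2⟩
    exact isMarkov_of_subsingleton
  | cast i => exact hW p i

variable {W} in
lemma PhysicallyDegraded.sum_cutKernel_le_condProb [∀ j, Finite (X j)] [∀ j, Fintype (Y j)]
    [DecidableEq (Y j × (∀ k : {k // j < k}, Y k))]
    (hW : PhysicallyDegraded W) (x : ∀ j, X j) (z : Y j × (∀ k : {k // j < k}, Y k)) :
    ∑ y with tailFrom j y = z, cutKernel W p j x y ≤
      condProb (jointLaw W p) (fun ω => tailFrom j ω.2) (fun ω => after j ω.1) z (after j x) := by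
  obtain ⟨b, z⟩ := z
  set ν := jointLaw W p
  set α := condProb ν (fun ω => ω.2 j) (fun ω => after j ω.1) b (after j x)
  set β := condProb ν (fun ω => ω.2 j) Prod.fst b x with hβ
  have hsum : ∑ y with tailFrom j y = (b, z), cutKernel W p j x y =
      prob (W x) (tailFrom j) (b, z) * (α / β) := by
    rw [prob_eq_sum, Finset.sum_mul]
    refine Finset.sum_congr rfl fun y hy => ?_
    obtain rfl : y j = b := congrArg Prod.fst (Finset.mem_filter.1 hy).2
    rfl
  rw [hsum]
  by_cases hβ₀ : β = 0
  · rw [hβ₀, div_zero, mul_zero]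
    exact condProb_nonneg _ _ _ _ _
  have hpair : prob ν (fun ω => (ω.2 j, ω.1)) (b, x) ≠ 0 := (div_ne_zero_iff.1 hβ₀).1
  have hx : (p x).toReal ≠ 0 := by
    rw [← prob_id p, ← prob_jointLaw_comp_fst W p]
    exact (div_ne_zero_iff.1 hβ₀).2
  let split (v : Y j × (∀ j, X j)) := (upTo j v.2, v.1, after j v.2)
  have hinj : split.Injective := fun v v' h => by
    simp only [split, Prod.mk.injEq] at h
    exact Prod.ext h.2.1 (upTo_after_injective j (Prod.ext h.1 h.2.2))
  have hmarkov : condProb ν (fun ω => after j ω.2) (fun ω => (ω.2 j, ω.1)) z (b, x) =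
      condProb ν (fun ω => after j ω.2) (fun ω => (ω.2 j, after j ω.1)) z (b, after j x) := by
    rw [← (hW.isMarkov p j).condProb_eq (a := upTo j x)]
    · exact (condProb_comp_of_injective ν _ (fun ω => (ω.2 j, ω.1)) hinj z (b, x)).symm
    · rwa [← prob_comp_of_injective ν _ hinj] at hpair
  have hW' := condProb_jointLaw_fst W p (tailFrom j) (b, z) hx
  refine le_of_eq ?_
  rw [← hW']
  change condProb ν (fun ω => (ω.2 j, after j ω.2)) _ _ _ * _ =
    condProb ν (fun ω => (ω.2 j, after j ω.2)) _ _ _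
  rw [condProb_pair', condProb_pair', hmarkov, mul_assoc, ← hβ, mul_div_cancel₀ _ hβ₀]

variable {W} in
lemma PhysicallyDegraded.sum_cutKernel_le_one [∀ j, Finite (X j)] [∀ j, Fintype (Y j)]
    (hW : PhysicallyDegraded W) (x : ∀ j, X j) : ∑ y, cutKernel W p j x y ≤ 1 := by
  classical
  rw [← Finset.sum_fiberwise _ (tailFrom j)]
  exact (Finset.sum_le_sum fun z _ => hW.sum_cutKernel_le_condProb p j x z).trans
    (sum_condProb_le_one _ _ _ _)

lemma DegradedSideInfo.sum_div_condProb_le {S : Fin (K + 2) → Type*} [∀ i, Fintype (S i)]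
    [DecidableEq (S 0 × S j.succ × (∀ k : {k // j.succ < k}, S k))]
    {q : PMF (∀ i, S i)} (hq : DegradedSideInfo q)
    (z : S 0 × S j.succ × (∀ k : {k // j.succ < k}, S k)) :
    ∑ s with (s 0, tailFrom j.succ s) = z,
      (q s).toReal / condProb q (fun s => s 0) (fun s => s j.succ) (s 0) (s j.succ) ≤
        prob q (tailFrom j.succ) z.2 := by
  obtain ⟨a, b, c⟩ := z
  have hM : IsMarkov q (fun s => s 0) (fun s => s j.succ) (fun s => after j.succ s) :=
    (hq j.succ).comp_left fun z => z ⟨0, j.succ_pos⟩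
  have hprob := hM.prob_eq_mul_condProb a b c
  calc _ = prob q (fun s => (s 0, tailFrom j.succ s)) (a, b, c) /
        condProb q (fun s => s 0) (fun s => s j.succ) a b := by
        rw [prob_eq_sum, Finset.sum_div]
        refine Finset.sum_congr rfl fun s hs => ?_
        have hs := (Finset.mem_filter.1 hs).2
        obtain rfl : s 0 = a := congrArg Prod.fst hs
        obtain rfl : s j.succ = b := congrArg (fun z => z.2.1) hs
        rfl
    _ = condProb q (fun s => s 0) (fun s => s j.succ) a b *
        prob q (tailFrom j.succ) (b, c) / condProb q (fun s => s 0) (fun s => s j.succ) a b :=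
        congrArg (· / _) hprob
    _ ≤ prob q (tailFrom j.succ) (b, c) := by
        rw [mul_comm, mul_div_assoc]
        exact mul_le_of_le_one_right (prob_nonneg _ _ _) (div_self_le_one _)

end Cut

section CodeLaw

variable {K : ℕ} {X Y : Fin (K + 1) → Type*} {S : Fin (K + 2) → Type*} {m n : ℕ}

lemma Code.causal_input (c : Code X Y S m n) (s : Fin m → ∀ i, S i) : Causal (c.input s) := by
  intro t y y' h
  funext j
  induction j using Fin.cases with
  | zero => rfl
  | succ i =>
    exact congrArg (fun z => c.relay i t z _) (funext fun u => by rw [h _ (Fin.lt_def.2 u.2)])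

lemma Code.after_input_congr (c : Code X Y S m n) (j : Fin (K + 1)) {s s' : Fin m → ∀ i, S i}
    (hs : ∀ k, tailFrom j.succ (s k) = tailFrom j.succ (s' k)) {y y' : Fin n → ∀ j, Y j}
    {t : Fin n} (hy : ∀ u < t, tailFrom j (y u) = tailFrom j (y' u)) :
    after j (c.input s y t) = after j (c.input s' y' t) := by
  funext ⟨k, hk⟩
  change c.input s y t k = c.input s' y' t k
  induction k using Fin.cases with
  | zero => exact absurd hk (Fin.not_lt_zero j)
  | succ i =>
    have hji : j ≤ i.castSucc := Fin.le_castSucc_iff.2 hk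
    exact congrArg₂ (c.relay i t)
      (funext fun u => eq_of_tailFrom_eq (hy _ (Fin.lt_def.2 u.2)) hji)
      (funext fun k => eq_of_tailFrom_eq (hs k) (Fin.succ_le_succ_iff.2 hji))

lemma Code.exists_tail_form [Nonempty (∀ j, Y j)] [Nonempty (∀ i, S i)] (c : Code X Y S m n)
    (j : Fin (K + 1)) :
    ∃ (v : (Fin m → S j.succ × (∀ k : {k // j.succ < k}, S k)) →
        (Fin n → Y j × (∀ k : {k // j < k}, Y k)) → Fin n → (∀ k : {k // j < k}, X k))
      (d : (Fin m → S j.succ × (∀ k : {k // j.succ < k}, S k)) →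
        (Fin n → Y j × (∀ k : {k // j < k}, Y k)) → Fin m → S 0),
      (∀ b, Causal (v b)) ∧
      (∀ s y t, after j (c.input s y t) = v (tailFrom j.succ ∘ s) (tailFrom j ∘ y) t) ∧
      ∀ s y, c.dec (fun t => y t (Fin.last K)) (fun k => s k (Fin.last K).succ) =
        d (tailFrom j.succ ∘ s) (tailFrom j ∘ y) := by
  obtain ⟨ly, hly⟩ := (tailFrom_surjective (Z := Y) j).hasRightInverse
  obtain ⟨ls, hls⟩ := (tailFrom_surjective (Z := S) j.succ).hasRightInverse
  refine ⟨fun b z t => after j (c.input (ls ∘ b) (ly ∘ z) t),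
    fun b z => c.dec (fun t => ly (z t) (Fin.last K)) (fun k => ls (b k) (Fin.last K).succ),
    fun b t z z' h => c.after_input_congr j (fun _ => rfl) fun u hu => by
      rw [Function.comp_apply, Function.comp_apply, h u hu],
    fun s y t => c.after_input_congr j (fun _ => (hls _).symm) fun _ _ => (hly _).symm,
    fun s y => congrArg₂ c.dec (funext fun t => ?_) (funext fun k => ?_)⟩
  · exact (eq_of_tailFrom_eq (hly _) (Fin.le_last j)).symm
  · exact (eq_of_tailFrom_eq (hls _) (Fin.succ_le_succ_iff.2 (Fin.le_last j))).symm

/-- The joint probability of the source samples `s` and the channel outputs `y`. -/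
def Code.law (c : Code X Y S m n) (W : (∀ j, X j) → PMF (∀ j, Y j)) (q : PMF (∀ i, S i))
    (s : Fin m → ∀ i, S i) (y : Fin n → ∀ j, Y j) : ℝ :=
  (∏ k, (q (s k)).toReal) * feedbackLaw (fun x y => (W x y).toReal) (c.input s) y

/-- The decoder recovers the source samples. -/
def Code.Correct (c : Code X Y S m n) (s : Fin m → ∀ i, S i) (y : Fin n → ∀ j, Y j) : Prop :=
  c.dec (fun t => y t (Fin.last K)) (fun k => s k (Fin.last K).succ) = fun k => s k 0

variable (c : Code X Y S m n) (W : (∀ j, X j) → PMF (∀ j, Y j)) (q : PMF (∀ i, S i))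

lemma Code.law_nonneg (s : Fin m → ∀ i, S i) (y : Fin n → ∀ j, Y j) : 0 ≤ c.law W q s y :=
  mul_nonneg (Finset.prod_nonneg fun _ _ => ENNReal.toReal_nonneg)
    (feedbackLaw_nonneg (fun _ _ => ENNReal.toReal_nonneg) _ _)

open scoped Classical in
lemma Code.errorProb_eq_sum [∀ j, Fintype (Y j)] [∀ i, Fintype (S i)] :
    c.errorProb W q = ∑ s, ∑ y, if c.Correct s y then 0 else c.law W q s y := by
  refine Finset.sum_congr rfl fun s _ => Finset.sum_congr rfl fun y _ => ?_
  by_cases h : c.Correct s y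
  · rw [if_pos h]
    exact if_neg (not_not_intro h)
  · rw [if_neg h]
    exact if_pos h

lemma Code.errorProb_nonneg [∀ j, Fintype (Y j)] [∀ i, Fintype (S i)] : 0 ≤ c.errorProb W q := by
  rw [c.errorProb_eq_sum]
  refine Finset.sum_nonneg fun s _ => Finset.sum_nonneg fun y _ => ?_
  split_ifs
  exacts [le_rfl, c.law_nonneg W q s y]

lemma Code.sum_law [∀ j, Fintype (Y j)] [Nonempty (∀ j, Y j)] (s : Fin m → ∀ i, S i) :
    ∑ y, c.law W q s y = ∏ k, (q (s k)).toReal := by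
  simp only [Code.law]
  rw [← Finset.mul_sum, sum_feedbackLaw_eq_one (fun x => sum_toReal_eq_one (W x))
    (c.causal_input s), mul_one]

variable [∀ j, Fintype (Y j)] [Nonempty (∀ j, Y j)] [∀ i, Fintype (S i)]

lemma Code.sum_sum_law_mul (F : (Fin m → ∀ i, S i) → ℝ) :
    ∑ s, ∑ y, c.law W q s y * F s = ∑ s, (piPMF (fun _ : Fin m => q) s).toReal * F s := by
  simp only [← Finset.sum_mul, c.sum_law, toReal_piPMF_apply]

lemma Code.sum_sum_law_eq_one : ∑ s, ∑ y, c.law W q s y = 1 := by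
  simpa [sum_toReal_eq_one] using c.sum_sum_law_mul W q fun _ => 1

end CodeLaw

section Converse

lemma sum_mul_le_of_sum_mul_exp_le {Ω : Type*} [Fintype Ω] {P T : Ω → ℝ} {C : ℝ}
    (hP : ∀ ω, 0 ≤ P ω) (hP₁ : ∑ ω, P ω = 1) (h : ∑ ω, P ω * Real.exp (T ω) ≤ C) :
    ∑ ω, P ω * T ω ≤ C - 1 := by
  calc ∑ ω, P ω * T ω ≤ ∑ ω, (P ω * Real.exp (T ω) - P ω) := Finset.sum_le_sum fun ω _ => by
        nlinarith [mul_le_mul_of_nonneg_left (Real.add_one_le_exp (T ω)) (hP ω)]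
    _ ≤ C - 1 := by rw [Finset.sum_sub_distrib, hP₁]; linarith

/-- Each value `z` of the data is a correct guess for a single `a`. -/
lemma sum_prod_mul_sum_guess_le {A B 𝒱 𝒵 : Type*} [Fintype A] [DecidableEq A] [Fintype B]
    [Fintype 𝒵] {m n : ℕ} {ρ : B → ℝ} (hρ : ∀ b, 0 ≤ ρ b) (hρ₁ : ∑ b, ρ b = 1) {U : 𝒱 → 𝒵 → ℝ}
    (hU : ∀ v z, 0 ≤ U v z) (hU₁ : ∀ v, ∑ z, U v z ≤ 1)
    {v : (Fin m → B) → (Fin n → 𝒵) → Fin n → 𝒱} (hv : ∀ b, Causal (v b))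
    (d : (Fin m → B) → (Fin n → 𝒵) → Fin m → A) :
    ∑ ab : Fin m → A × B, (∏ k, ρ (ab k).2) * ∑ z, feedbackLaw U (v fun k => (ab k).2) z *
      (if (d (fun k => (ab k).2) z = fun k => (ab k).1) then 1 else 0) ≤ 1 := by
  calc _ = ∑ b : Fin m → B, (∏ k, ρ (b k)) * ∑ z, feedbackLaw U (v b) z := by
        rw [← (Equiv.arrowProdEquivProdArrow (Fin m) (fun _ => A) fun _ => B).symm.sum_comp,
          Fintype.sum_prod_type_right]
        refine Finset.sum_congr rfl fun b _ => ?_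
        simp only [Equiv.arrowProdEquivProdArrow, Equiv.coe_fn_symm_mk]
        rw [← Finset.mul_sum, Finset.sum_comm]
        exact congrArg _ (Finset.sum_congr rfl fun z _ =>
          (Finset.sum_mul_boole _ _ _).trans (if_pos (Finset.mem_univ _)))
    _ ≤ ∑ b : Fin m → B, ∏ k, ρ (b k) := Finset.sum_le_sum fun b _ =>
        mul_le_of_le_one_right (Finset.prod_nonneg fun k _ => hρ (b k))
          (sum_feedbackLaw_le_one hU hU₁ (hv b))
    _ = 1 := by
        rw [← Fintype.prod_sum fun _ b => ρ b]
        simp [hρ₁]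

variable {K : ℕ} {X Y : Fin (K + 1) → Type*} {S : Fin (K + 2) → Type*} {m n : ℕ}
  {W : (∀ j, X j) → PMF (∀ j, Y j)} {q : PMF (∀ i, S i)}

open scoped Classical in
lemma Code.law_mul_exp_le (c : Code X Y S m n) {p : PMF (∀ j, X j)} (j : Fin (K + 1))
    {s : Fin m → ∀ i, S i} {y : Fin n → ∀ j, Y j}
    (hpos : 0 < c.law W q s y → ∀ t, 0 < (jointLaw W p (c.input s y t, y t)).toReal) :
    c.law W q s y * Real.exp ((if c.Correct s y then
        ∑ k, -Real.log (condProb q (fun s => s 0) (fun s => s j.succ) (s k 0) (s k j.succ))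
        else 0) - ∑ t, cutDensity W p j (c.input s y t, y t)) ≤
      (∏ k, (q (s k)).toReal) * feedbackLaw (cutKernel W p j) (c.input s) y +
        (∏ k, (q (s k)).toReal /
          condProb q (fun s => s 0) (fun s => s j.succ) (s k 0) (s k j.succ)) *
        (feedbackLaw (cutKernel W p j) (c.input s) y * (if c.Correct s y then 1 else 0)) := by
  have hsource : 0 ≤ ∏ k, (q (s k)).toReal := Finset.prod_nonneg fun _ _ => ENNReal.toReal_nonneg
  have hguess : 0 ≤ ∏ k, (q (s k)).toReal /
      condProb q (fun s => s 0) (fun s => s j.succ) (s k 0) (s k j.succ) :=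
    Finset.prod_nonneg fun _ _ => div_nonneg ENNReal.toReal_nonneg (condProb_nonneg _ _ _ _ _)
  have hcut : 0 ≤ feedbackLaw (cutKernel W p j) (c.input s) y :=
    feedbackLaw_nonneg (cutKernel_nonneg W p j) _ _
  rcases (c.law_nonneg W q s y).eq_or_lt with hlaw | hlaw
  · rw [← hlaw, zero_mul]
    exact add_nonneg (mul_nonneg hsource hcut)
      (mul_nonneg hguess (mul_nonneg hcut (by split_ifs <;> simp)))
  have hchannel : feedbackLaw (cutKernel W p j) (c.input s) y =
      feedbackLaw (fun x y => (W x y).toReal) (c.input s) y *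
        Real.exp (-∑ t, cutDensity W p j (c.input s y t, y t)) := by
    rw [← Finset.sum_neg_distrib, Real.exp_sum, feedbackLaw, feedbackLaw,
      ← Finset.prod_mul_distrib]
    exact Finset.prod_congr rfl fun t _ => cutKernel_eq p j (hpos hlaw t)
  split_ifs
  · have hsample (k : Fin m) : 0 < (q (s k)).toReal := ENNReal.toReal_nonneg.lt_of_ne' <|
      Finset.prod_ne_zero_iff.1 (left_ne_zero_of_mul hlaw.ne') k (Finset.mem_univ k)
    have hinv : ∏ k, (q (s k)).toReal /
        condProb q (fun s => s 0) (fun s => s j.succ) (s k 0) (s k j.succ) =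
        (∏ k, (q (s k)).toReal) * Real.exp (∑ k, -Real.log
          (condProb q (fun s => s 0) (fun s => s j.succ) (s k 0) (s k j.succ))) := by
      rw [Real.exp_sum, ← Finset.prod_mul_distrib]
      refine Finset.prod_congr rfl fun k _ => ?_
      rw [Real.exp_neg, Real.exp_log (condProb_pos q (fun s => s 0) _ (hsample k)), div_eq_mul_inv]
    refine le_add_of_nonneg_of_le (mul_nonneg hsource hcut) (le_of_eq ?_)
    rw [hinv, hchannel, Code.law, sub_eq_add_neg, Real.exp_add]
    ring
  · refine le_add_of_le_of_nonneg (le_of_eq ?_) (by simp)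
    rw [hchannel, Code.law, zero_sub, mul_assoc]

variable [∀ j, Fintype (Y j)] [∀ i, Fintype (S i)]

open scoped Classical in
/-- When the output `Y_j` is generated from the inputs after `X_j` only, the decoder does not
beat guessing the source from the side information `S_{j+1}`. -/
lemma Code.sum_cutKernel_correct_le [∀ j, Finite (X j)] (c : Code X Y S m n)
    (hW : PhysicallyDegraded W) (hq : DegradedSideInfo q) (p : PMF (∀ j, X j)) (j : Fin (K + 1)) :
    ∑ s, (∏ k, (q (s k)).toReal /
        condProb q (fun s => s 0) (fun s => s j.succ) (s k 0) (s k j.succ)) *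
      ∑ y, feedbackLaw (cutKernel W p j) (c.input s) y * (if c.Correct s y then 1 else 0) ≤ 1 := by
  have := nonempty_of_pmf q
  have := nonempty_of_pmf p
  have := nonempty_of_pmf (W (Classical.arbitrary _))
  obtain ⟨v, d, hv, hinput, hdec⟩ := c.exists_tail_form j
  set U := fun v z =>
    condProb (jointLaw W p) (fun ω => tailFrom j ω.2) (fun ω => after j ω.1) z v
  have hU (v z) : 0 ≤ U v z := condProb_nonneg _ _ _ _ _
  let guess (ab : Fin m → S 0 × S j.succ × (∀ k : {k // j.succ < k}, S k)) : ℝ :=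
    ∑ z, feedbackLaw U (v fun k => (ab k).2) z *
      (if (d (fun k => (ab k).2) z = fun k => (ab k).1) then 1 else 0)
  have hguess (ab) : 0 ≤ guess ab := Finset.sum_nonneg fun z _ =>
    mul_nonneg (feedbackLaw_nonneg hU _ _) (by split_ifs <;> simp)
  have hchannel (s : Fin m → ∀ i, S i) : ∑ y, feedbackLaw (cutKernel W p j) (c.input s) y *
      (if c.Correct s y then 1 else 0) ≤ guess fun k => (s k 0, tailFrom j.succ (s k)) := by
    simp only [Code.Correct, hdec]
    exact sum_feedbackLaw_comp_le (cutKernel_nonneg W p j) hU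
      (hW.sum_cutKernel_le_condProb p j) (c.causal_input s) (hv _) (hinput s)
      (F := fun z => if d (tailFrom j.succ ∘ s) z = fun k => s k 0 then 1 else 0)
      fun z => by split_ifs <;> simp
  have hsource := sum_feedbackLaw_comp_le (n := m) (F := guess)
    (Q := fun _ s => (q s).toReal / condProb q (fun s => s 0) (fun s => s j.succ) (s 0) (s j.succ))
    (U := fun _ z => prob q (tailFrom j.succ) z.2) (x := fun _ _ => ()) (v := fun _ _ => ())
    (fun _ s => div_nonneg ENNReal.toReal_nonneg (condProb_nonneg _ _ _ _ _))
    (fun _ _ => prob_nonneg _ _ _) (fun _ => hq.sum_div_condProb_le j)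
    (ρ := fun _ => ()) (fun _ _ _ _ => rfl) (fun _ _ _ _ => rfl) (fun _ _ => rfl) hguess
  refine (Finset.sum_le_sum fun s _ => mul_le_mul_of_nonneg_left (hchannel s) ?_).trans
    (hsource.trans ?_)
  · exact Finset.prod_nonneg fun k _ =>
      div_nonneg ENNReal.toReal_nonneg (condProb_nonneg _ _ _ _ _)
  · exact sum_prod_mul_sum_guess_le (fun _ => prob_nonneg _ _ _) (sum_prob q (tailFrom j.succ)) hU
      (fun v => sum_condProb_le_one _ _ _ v) hv d

lemma Code.exists_pmf_average [∀ j, Fintype (X j)] (c : Code X Y S m n)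
    (W : (∀ j, X j) → PMF (∀ j, Y j)) (q : PMF (∀ i, S i)) [Nonempty (∀ j, Y j)] (hn : 0 < n) :
    ∃ p : PMF (∀ j, X j), ∀ F : (∀ j, X j) × (∀ j, Y j) → ℝ,
      n * ∑ ω, (jointLaw W p ω).toReal * F ω =
        ∑ s, ∑ y, c.law W q s y * ∑ t, F (c.input s y t, y t) := by
  have hn₀ : (n : ℝ) ≠ 0 := by positivity
  obtain ⟨R, hR⟩ := exists_pmf_toReal_eq
    (w := fun r : Fin n × (Fin m → ∀ i, S i) × (Fin n → ∀ j, Y j) => c.law W q r.2.1 r.2.2 / n)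
    (fun r => div_nonneg (c.law_nonneg W q _ _) n.cast_nonneg) <| by
      simp [Fintype.sum_prod_type, ← Finset.sum_div, c.sum_sum_law_eq_one, hn₀]
  refine ⟨R.map fun r => c.input r.2.1 r.2.2 r.1, fun F => ?_⟩
  set G : (∀ j, X j) → ℝ := fun x => ∑ b, (W x b).toReal * F (x, b) with hG
  have hjoint : ∑ ω, (jointLaw W (R.map fun r => c.input r.2.1 r.2.2 r.1) ω).toReal * F ω =
      ∑ x, prob R (fun r => c.input r.2.1 r.2.2 r.1) x * G x := by
    simp only [Fintype.sum_prod_type, toReal_jointLaw_apply, hG, Finset.mul_sum, mul_assoc]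
    rfl
  have hcausal (s : Fin m → ∀ i, S i) (t : Fin n) :
      ∑ y, c.law W q s y * G (c.input s y t) =
        ∑ y, c.law W q s y * F (c.input s y t, y t) := by
    simp only [Code.law, mul_assoc, ← Finset.mul_sum]
    rw [sum_feedbackLaw_mul_eq_sum_expect (fun x => sum_toReal_eq_one (W x)) (c.causal_input s)
      (fun x b => F (x, b)) t]
  calc _ = n * ((∑ t, ∑ s, ∑ y, c.law W q s y * G (c.input s y t)) / n) := by
        simp only [hjoint, sum_prob_mul, hR, Fintype.sum_prod_type, div_mul_eq_mul_div,
          Finset.sum_div]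
    _ = ∑ t, ∑ s, ∑ y, c.law W q s y * F (c.input s y t, y t) := by
        simp only [mul_div_cancel₀ _ hn₀, hcausal]
    _ = _ := by
        rw [Finset.sum_comm]
        refine Finset.sum_congr rfl fun s _ => ?_
        rw [Finset.sum_comm]
        simp only [Finset.mul_sum]

lemma Code.jointLaw_pos [∀ j, Fintype (X j)] (c : Code X Y S m n) {p : PMF (∀ j, X j)}
    (hp : ∀ F : (∀ j, X j) × (∀ j, Y j) → ℝ, n * ∑ ω, (jointLaw W p ω).toReal * F ω =
      ∑ s, ∑ y, c.law W q s y * ∑ t, F (c.input s y t, y t))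
    {s : Fin m → ∀ i, S i} {y : Fin n → ∀ j, Y j} (h : 0 < c.law W q s y) (t : Fin n) :
    0 < (jointLaw W p (c.input s y t, y t)).toReal := by
  classical
  set ω := (c.input s y t, y t)
  let F : (∀ j, X j) × (∀ j, Y j) → ℝ := Pi.single ω 1
  have hF (ω') : 0 ≤ F ω' := (Pi.single_nonneg (α := fun _ => ℝ)).2 zero_le_one ω'
  have hlaw (s y) : 0 ≤ c.law W q s y * ∑ t, F (c.input s y t, y t) :=
    mul_nonneg (c.law_nonneg W q s y) (Finset.sum_nonneg fun t _ => hF _)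
  have hle : c.law W q s y ≤ n * (jointLaw W p ω).toReal := by
    calc c.law W q s y = c.law W q s y * F ω := by simp [F]
      _ ≤ c.law W q s y * ∑ t, F (c.input s y t, y t) := mul_le_mul_of_nonneg_left
          (Finset.single_le_sum (f := fun t => F (c.input s y t, y t)) (fun t _ => hF _)
            (Finset.mem_univ t)) h.le
      _ ≤ ∑ y, c.law W q s y * ∑ t, F (c.input s y t, y t) :=
          Finset.single_le_sum (f := fun y => c.law W q s y * ∑ t, F (c.input s y t, y t))
            (fun y _ => hlaw s y) (Finset.mem_univ y)
      _ ≤ ∑ s, ∑ y, c.law W q s y * ∑ t, F (c.input s y t, y t) :=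
          Finset.single_le_sum
            (f := fun s => ∑ y, c.law W q s y * ∑ t, F (c.input s y t, y t))
            (fun s _ => Finset.sum_nonneg fun y _ => hlaw s y) (Finset.mem_univ s)
      _ = n * (jointLaw W p ω).toReal := (hp F).symm.trans (by simp [F, Pi.single_apply])
  exact pos_of_mul_pos_right (h.trans_le hle) n.cast_nonneg

open scoped Classical in
lemma Code.mul_sub_le_sum_correct [Nonempty (∀ j, Y j)] (c : Code X Y S m n)
    (W : (∀ j, X j) → PMF (∀ j, Y j)) (q : PMF (∀ i, S i)) {ℓ : (∀ i, S i) → ℝ} {L : ℝ}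
    (hℓ : ∀ s, ℓ s ≤ L) :
    m * ∑ s, (q s).toReal * ℓ s - m * L * c.errorProb W q ≤
      ∑ s, ∑ y, c.law W q s y * (if c.Correct s y then ∑ k, ℓ (s k) else 0) := by
  have hmean : m * ∑ s, (q s).toReal * ℓ s = ∑ s, ∑ y, c.law W q s y * ∑ k, ℓ (s k) := by
    rw [c.sum_sum_law_mul W q fun s => ∑ k, ℓ (s k)]
    simp only [Finset.mul_sum]
    rw [Finset.sum_comm]
    simp only [sum_piPMF_mul_apply (fun _ : Fin m => q) _ ℓ]
    simp [Finset.mul_sum]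
  rw [hmean, c.errorProb_eq_sum, Finset.mul_sum, ← Finset.sum_sub_distrib]
  refine Finset.sum_le_sum fun s _ => ?_
  rw [Finset.mul_sum, ← Finset.sum_sub_distrib]
  refine Finset.sum_le_sum fun y _ => ?_
  split_ifs
  · simp
  · rw [mul_comm (_ * L), ← mul_sub, mul_zero]
    refine mul_nonpos_of_nonneg_of_nonpos (c.law_nonneg W q s y) (sub_nonpos.2 ?_)
    refine (Finset.sum_le_sum fun k _ => hℓ (s k)).trans ?_
    simp

lemma Code.exists_input_bound [∀ j, Fintype (X j)] (c : Code X Y S m n)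
    (hW : PhysicallyDegraded W) (hq : DegradedSideInfo q) (hn : 0 < n) :
    ∃ p : PMF (∀ j, X j), ∀ j : Fin (K + 1),
      m * condEntropy q (fun s => s 0) (fun s => s j.succ) -
        m * (∑ s : ∀ i, S i,
          -Real.log (condProb q (fun s => s 0) (fun s => s j.succ) (s 0) (s j.succ))) *
          c.errorProb W q - 1 ≤ n * cutInfo W p j := by
  classical
  have ⟨s₀⟩ := nonempty_of_pmf q
  let x₀ : ∀ j, X j := Fin.cases (c.enc (fun _ => s₀ 0) ⟨0, hn⟩)
    fun i => c.relay i ⟨0, hn⟩ (fun u => absurd u.2 (Nat.not_lt_zero _)) fun _ => s₀ _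
  have := nonempty_of_pmf (W x₀)
  obtain ⟨p, hp⟩ := c.exists_pmf_average W q hn
  refine ⟨p, fun j => ?_⟩
  set ℓ : (∀ i, S i) → ℝ := fun s =>
    -Real.log (condProb q (fun s => s 0) (fun s => s j.succ) (s 0) (s j.succ))
  set gain : (Fin m → ∀ i, S i) → (Fin n → ∀ j, Y j) → ℝ := fun s y =>
    if c.Correct s y then ∑ k, ℓ (s k) else 0
  have hℓ (s) : ℓ s ≤ ∑ s, ℓ s := Finset.single_le_sum (f := ℓ) (fun s _ => neg_nonneg.2 <|
    Real.log_nonpos (condProb_nonneg _ _ _ _ _) (condProb_le_one _ _ _ _ _)) (Finset.mem_univ s)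
  have hchange : ∑ sy : (Fin m → ∀ i, S i) × (Fin n → ∀ j, Y j), c.law W q sy.1 sy.2 *
      Real.exp (gain sy.1 sy.2 - ∑ t, cutDensity W p j (c.input sy.1 sy.2 t, sy.2 t)) ≤ 2 := by
    refine (Finset.sum_le_sum fun sy _ =>
      c.law_mul_exp_le j fun h t => c.jointLaw_pos hp h t).trans ?_
    simp only [Fintype.sum_prod_type, Finset.sum_add_distrib, ← Finset.mul_sum]
    refine (add_le_add ?_ (c.sum_cutKernel_correct_le hW hq p j)).trans_eq one_add_one_eq_two
    calc _ ≤ ∑ s, (piPMF (fun _ : Fin m => q) s).toReal := Finset.sum_le_sum fun s _ => by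
          rw [toReal_piPMF_apply]
          exact mul_le_of_le_one_right (Finset.prod_nonneg fun _ _ => ENNReal.toReal_nonneg)
            (sum_feedbackLaw_le_one (cutKernel_nonneg W p j) (hW.sum_cutKernel_le_one p j)
              (c.causal_input s))
      _ = 1 := sum_toReal_eq_one _
  have hgibbs := sum_mul_le_of_sum_mul_exp_le (fun sy => c.law_nonneg W q _ _)
    (by rw [Fintype.sum_prod_type, c.sum_sum_law_eq_one]) hchange
  simp only [Fintype.sum_prod_type, mul_sub, Finset.sum_sub_distrib] at hgibbs
  rw [← hp, ← cutInfo_eq_sum] at hgibbs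
  have hgain := c.mul_sub_le_sum_correct W q hℓ
  rw [condEntropy_eq_sum]
  simp only [ℓ, gain] at hgain hgibbs ⊢
  linarith

lemma mul_le_of_converse_bound {a r H L I e m n : ℝ} (ha : 0 ≤ a) (hH : 0 ≤ H) (har : a < r)
    (hm : 0 < m) (hn : 0 < n) (hr : r ≤ m / n) (hI : m * H - m * L * e - 1 ≤ n * I)
    (hlim : a * H < r * (H - L * e - m⁻¹)) : a * H ≤ I := by
  set β := H - L * e - m⁻¹ with hβ
  have hβ₀ : 0 < β := pos_of_mul_pos_right ((mul_nonneg ha hH).trans_lt hlim) (ha.trans har.le)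
  refine hlim.le.trans (le_of_mul_le_mul_left ?_ hn)
  calc n * (r * β) = r * n * β := by ring
    _ ≤ m * β := mul_le_mul_of_nonneg_right ((le_div_iff₀ hn).1 hr) hβ₀.le
    _ = m * H - m * L * e - 1 := by rw [hβ, mul_sub, mul_sub, mul_inv_cancel₀ hm.ne', mul_assoc]
    _ ≤ n * I := hI

lemma sourceChannelCapacity_le [∀ j, Fintype (X j)] (hW : PhysicallyDegraded W)
    (hq : DegradedSideInfo q) :
    sourceChannelCapacity W q ≤ ⨆ p : PMF (∀ j, X j), ⨅ j : Fin (K + 1),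
      ratio (cutInfo W p j) (condEntropy q (fun s => s 0) (fun s => s j.succ)) := by
  refine iSup₂_le fun r ⟨m, n, c, hmn, hm, _, herr⟩ =>
    le_of_forall_lt_imp_le_of_dense fun a ha => ?_
  lift a to ℝ≥0 using (ha.trans ENNReal.coe_lt_top).ne
  have har : (a : ℝ) < r := ENNReal.coe_lt_coe.1 ha
  set H : Fin (K + 1) → ℝ := fun j => condEntropy q (fun s => s 0) (fun s => s j.succ)
  set L : Fin (K + 1) → ℝ := fun j =>
    ∑ s : ∀ i, S i, -Real.log (condProb q (fun s => s 0) (fun s => s j.succ) (s 0) (s j.succ))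
  have hH (j) (hj : H j ≠ 0) : 0 < H j := (condEntropy_nonneg _ _ _).lt_of_ne' hj
  have hinv : Tendsto (fun k => (m k : ℝ)⁻¹) atTop (𝓝 0) :=
    tendsto_inv_atTop_zero.comp (tendsto_natCast_atTop_atTop.comp hm)
  have hlim (j) (hj : H j ≠ 0) : ∀ᶠ k in atTop,
      a * H j < r * (H j - L j * (c k).errorProb W q - (m k : ℝ)⁻¹) :=
    (((((herr.const_mul (L j)).const_sub (H j)).sub hinv).const_mul (r : ℝ))).eventually_const_lt
      (by simpa using mul_lt_mul_of_pos_right har (hH j hj))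
  obtain ⟨k, hk, hmk⟩ := ((eventually_all.2 fun j => eventually_imp_distrib_left.2 (hlim j)).and
    (hm.eventually_gt_atTop 0)).exists
  obtain ⟨hn, hrate⟩ := hmn k
  obtain ⟨p, hp⟩ := (c k).exists_input_bound hW hq hn
  refine le_iSup_of_le p (le_iInf fun j => ?_)
  rw [ratio]
  split_ifs with hj
  · exact le_top
  rw [← ENNReal.ofReal_coe_nnreal]
  exact ENNReal.ofReal_le_ofReal <| (le_div_iff₀ (hH j hj)).2 <|
    mul_le_of_converse_bound a.2 (hH j hj).le har (by exact_mod_cast hmk) (by exact_mod_cast hn)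
      hrate (hp j) (hk j hj)

end Converse

section FunctionalRepresentation

universe u

variable {N : ℕ} {Z : Fin N → Type*}

/-- A letter for coordinate `k` of a tuple: a rule that computes it from the later coordinates.
When the letters are drawn independently, the tuple they assemble can have any law. -/
abbrev Letter (Z : Fin N → Type*) (k : Fin N) : Type _ :=
  (∀ i : {i // k < i}, Z i) → Z k

/-- The tuple computed from the letters `u`, starting at the last coordinate. -/
def assemble (u : ∀ k, Letter Z k) (k : Fin N) : Z k :=
  u k fun i => assemble u i
termination_by N - k
decreasing_by have := i.2; omega

lemma assemble_apply (u : ∀ k, Letter Z k) (k : Fin N) :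
    assemble u k = u k (after k (assemble u)) := by
  rw [assemble]
  rfl

lemma assemble_congr {u u' : ∀ k, Letter Z k} {k : Fin N} (h : ∀ i, k ≤ i → u i = u' i) :
    assemble u k = assemble u' k := by
  rw [assemble_apply, assemble_apply, h k le_rfl]
  exact congrArg _ (funext fun i => assemble_congr fun l hl => h l (i.2.le.trans hl))
termination_by N - k
decreasing_by have := i.2; omega

lemma eq_assemble {u : ∀ k, Letter Z k} {z : ∀ k, Z k} {k : Fin N}
    (h : ∀ i, k ≤ i → u i (after i z) = z i) : z k = assemble u k := by
  rw [assemble_apply, ← h k le_rfl]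
  exact congrArg _ (funext fun i => eq_assemble fun l hl => h l (i.2.le.trans hl))
termination_by N - k
decreasing_by have := i.2; omega

lemma tailFrom_succ_preimage {K : ℕ} {Z : Fin (K + 1) → Type*} (i : Fin K) (z : ∀ k, Z k) :
    tailFrom i.succ ⁻¹' {tailFrom i.succ z} = after i.castSucc ⁻¹' {after i.castSucc z} := by
  ext z'
  refine ⟨fun h => funext fun k => eq_of_tailFrom_eq h (Fin.castSucc_lt_iff_succ_le.1 k.2),
    fun h => Prod.ext (congrFun h ⟨i.succ, i.castSucc_lt_succ⟩)
      (funext fun k => congrFun h ⟨k, i.castSucc_lt_succ.trans k.2⟩)⟩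

lemma tailFrom_zero_injective {K : ℕ} {Z : Fin (K + 1) → Type*} :
    Function.Injective (tailFrom 0 : (∀ k, Z k) → _) :=
  fun _ _ h => funext fun k => eq_of_tailFrom_eq h k.zero_le

lemma prod_Iic_mul_of_telescope {K : ℕ} {R T A : Fin (K + 1) → ℝ} (hR : ∀ k, R k * A k = T k)
    (hA : ∀ i : Fin K, T i.succ = A i.castSucc) (j : Fin (K + 1)) :
    (∏ k ∈ Finset.Iic j, R k) * A j = T 0 := by
  induction j using Fin.induction with
  | zero =>
    have : Finset.Iic (0 : Fin (K + 1)) = {0} := by ext; simp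
    rw [this, Finset.prod_singleton, hR]
  | succ i ih =>
    have : Finset.Iic i.succ = insert i.succ (Finset.Iic i.castSucc) := by
      ext k
      simp [Fin.le_def, Fin.ext_iff]
      omega
    rw [this, Finset.prod_insert (by simp), mul_right_comm, hR, hA, mul_comm, ih]

variable {K : ℕ} {X Y : Fin (K + 1) → Type*} [∀ k, Fintype (X k)] [∀ k, DecidableEq (X k)]
  {p : PMF (∀ k, X k)}

lemma prob_assemble_after_eq_prod (κ : ∀ k, (∀ i : {i // k < i}, X i) → PMF (X k))
    {x : ∀ k, X k} {u : ∀ k, Letter X k} {j : Fin (K + 1)} (hx : after j x = after j (assemble u)) :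
    prob (piPMF fun k => piPMF (κ k)) (fun u => (assemble u, after j u)) (x, after j u) =
      (∏ k ∈ Finset.Iic j, (κ k (after k x) (x k)).toReal) *
        prob (piPMF fun k => piPMF (κ k)) (after j) (after j u) := by
  have hjoint (u' : ∀ k, Letter X k) : (assemble u', after j u') = (x, after j u) ↔
      ∀ k, if j < k then u' k = u k else u' k (after k x) = x k := by
    rw [Prod.mk.injEq]
    constructor
    · rintro ⟨rfl, hu'⟩ k
      split_ifs with hk
      exacts [congrFun hu' ⟨k, hk⟩, (assemble_apply u' k).symm]
    · intro h
      have hu' (k) (hk : j < k) : u' k = u k := by simpa only [if_pos hk] using h k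
      refine ⟨funext fun k => (eq_assemble fun i _ => ?_).symm, funext fun k => hu' k k.2⟩
      by_cases hi : j < i
      swap
      · simpa only [if_neg hi] using h i
      · have htail : after i x = after i (assemble u) :=
          funext fun l => congrFun hx ⟨l, hi.trans l.2⟩
        exact (congrArg _ htail).trans <| (congrFun (hu' i hi) _).trans <|
          (assemble_apply u i).symm.trans (congrFun hx ⟨i, hi⟩).symm
  have hafter (u' : ∀ k, Letter X k) : after j u' = after j u ↔ ∀ k, j < k → u' k = u k :=
    ⟨fun h k hk => congrFun h ⟨k, hk⟩, fun h => funext fun k => h k k.2⟩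
  rw [prob_piPMF_eq_prod _ (t := fun k a => if j < k then a = u k else a (after k x) = x k) hjoint,
    prob_piPMF_eq_prod _ (t := fun k a => j < k → a = u k) hafter,
    ← Finset.filter_ge_eq_Iic, Finset.prod_filter, ← Finset.prod_mul_distrib]
  refine Finset.prod_congr rfl fun k _ => ?_
  by_cases hk : j < k
  · simp [hk, hk.not_ge]
  · have hmarginal := prob_eq_sum (piPMF (κ k)) (fun a => a (after k x)) (x k)
    simp only [prob, map_piPMF_apply] at hmarginal
    simp [hk, not_lt.1 hk, hmarginal, sum_toReal_eq_one]

lemma prob_assemble_after_mul {κ : ∀ k, (∀ i : {i // k < i}, X i) → PMF (X k)}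
    (hκ : ∀ k c a, (κ k c a).toReal * prob p (after k) c = prob p (tailFrom k) (a, c))
    (x : ∀ k, X k) (u : ∀ k, Letter X k) (j : Fin (K + 1)) :
    prob (piPMF fun k => piPMF (κ k)) (fun u => (assemble u, after j u)) (x, after j u) *
        prob p (after j) (after j (assemble u)) =
      prob p (fun x => (x, after j x)) (x, after j (assemble u)) *
        prob (piPMF fun k => piPMF (κ k)) (after j) (after j u) := by
  set P := piPMF fun k => piPMF (κ k)
  by_cases hx : after j x = after j (assemble u)
  · have htelescope := prod_Iic_mul_of_telescope (fun k => hκ k (after k x) (x k))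
      (fun i => prob_eq_of_preimage_eq p (tailFrom_succ_preimage i x)) j
    rw [prob_assemble_after_eq_prod κ hx, mul_right_comm, ← hx, htelescope,
      show prob p (tailFrom 0) (x 0, after 0 x) =
          prob p (fun x => (x, after j x)) (x, after j x) from
        (prob_comp_of_injective p id tailFrom_zero_injective x).trans
          (prob_comp_of_injective p id (φ := fun x => (x, after j x))
            (fun _ _ h => (Prod.mk.inj h).1) x).symm]
  · have hassemble (u') (hu' : after j u' = after j u) :
        after j (assemble u') = after j (assemble u) := funext fun k =>
      assemble_congr fun i hi => congrFun hu' ⟨i, k.2.trans_le hi⟩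
    rw [prob_eq_toOuterMeasure P, prob_eq_toOuterMeasure p (fun x => (x, after j x)),
      Set.preimage_eq_empty, Set.preimage_eq_empty]
    · simp
    · simp only [Set.disjoint_singleton_left, Set.mem_range, Prod.mk.injEq]
      rintro ⟨x, rfl, h⟩
      exact hx h
    · simp only [Set.disjoint_singleton_left, Set.mem_range, Prod.mk.injEq]
      rintro ⟨u', rfl, hu'⟩
      exact hx (hassemble u' hu')

lemma prob_after_last {Z : Fin (K + 1) → Type*} (μ : PMF (∀ k, Z k)) (c) :
    prob μ (after (Fin.last K)) c = 1 := by
  have : IsEmpty {k // Fin.last K < k} := ⟨fun k => (Fin.le_last k.1).not_gt k.2⟩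
  rw [← sum_prob μ (after (Fin.last K)), Fintype.sum_subsingleton]

lemma prob_assemble {κ : ∀ k, (∀ i : {i // k < i}, X i) → PMF (X k)}
    (hκ : ∀ k c a, (κ k c a).toReal * prob p (after k) c = prob p (tailFrom k) (a, c))
    (x : ∀ k, X k) : prob (piPMF fun k => piPMF (κ k)) assemble x = (p x).toReal := by
  have : IsEmpty {k // Fin.last K < k} := ⟨fun k => (Fin.le_last k.1).not_gt k.2⟩
  obtain ⟨u⟩ := nonempty_of_pmf (piPMF fun k => piPMF (κ k))
  have h := prob_assemble_after_mul hκ x u (Fin.last K)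
  rw [prob_after_last, prob_after_last, mul_one, mul_one] at h
  rw [← prob_id p]
  refine (prob_eq_of_preimage_eq _ ?_).trans (h.trans (prob_eq_of_preimage_eq _ ?_))
  · ext u'
    rw [Set.mem_preimage, Set.mem_preimage, Set.mem_singleton_iff, Set.mem_singleton_iff,
      Prod.mk.injEq, and_iff_left (Subsingleton.elim _ _)]
  · ext x'
    rw [Set.mem_preimage, Set.mem_preimage, Set.mem_singleton_iff, Set.mem_singleton_iff,
      Prod.mk.injEq, and_iff_left (Subsingleton.elim _ _), id]

lemma prob_jointLaw_comp_pair [∀ k, Finite (Y k)] {U : Fin (K + 1) → Type*}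
    [∀ k, Finite (U k)] {A B Z : Type*} [Fintype Z] (W : Z → PMF (∀ k, Y k))
    (φ : (∀ k, U k) → Z) (P : PMF (∀ k, U k)) (f : (∀ k, Y k) → A) (g : (∀ k, U k) → B)
    (a : A) (b : B) :
    prob (jointLaw (fun u => W (φ u)) P) (fun ω => (f ω.2, g ω.1)) (a, b) =
      ∑ z, prob P (fun u => (φ u, g u)) (z, b) * prob (W z) f a := by
  classical
  have := fun k => Fintype.ofFinite (Y k)
  have := fun k => Fintype.ofFinite (U k)
  have hleft : prob (jointLaw (fun u => W (φ u)) P) (fun ω => (f ω.2, g ω.1)) (a, b) =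
      ∑ u with g u = b, (P u).toReal * prob (W (φ u)) f a := by
    simp only [prob_eq_sum, Finset.sum_filter, Fintype.sum_prod_type, toReal_jointLaw_apply,
      Prod.mk.injEq, Finset.mul_sum, mul_ite, mul_zero, ite_and]
    refine Finset.sum_congr rfl fun u _ => ?_
    split_ifs with hu <;> simp
  rw [hleft]
  simp only [prob_eq_sum P, Finset.sum_filter, Finset.sum_mul, Prod.mk.injEq, ite_and, ite_mul,
    zero_mul]
  rw [Finset.sum_comm]
  simp

lemma cutDensity_assemble [∀ k, Finite (Y k)] (W : (∀ k, X k) → PMF (∀ k, Y k))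
    {κ : ∀ k, (∀ i : {i // k < i}, X i) → PMF (X k)}
    (hκ : ∀ k c a, (κ k c a).toReal * prob p (after k) c = prob p (tailFrom k) (a, c))
    (j : Fin (K + 1)) {u : ∀ k, Letter X k}
    (hu : 0 < (piPMF (fun k => piPMF (κ k)) u).toReal) (y : ∀ k, Y k) :
    cutDensity (fun u => W (assemble u)) (piPMF fun k => piPMF (κ k)) j (u, y) =
      cutDensity W p j (assemble u, y) := by
  have hx : 0 < (p (assemble u)).toReal := prob_assemble hκ (assemble u) ▸ prob_pos _ assemble hu
  refine congrArg Real.log (congrArg₂ (· / ·) ?_ ?_)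
  · exact (condProb_jointLaw_fst _ _ (fun y => y j) _ hu.ne').trans
      (condProb_jointLaw_fst _ _ (fun y => y j) _ hx.ne').symm
  · have hU := prob_jointLaw_comp_fst (fun u => W (assemble u)) (piPMF fun k => piPMF (κ k))
      (after j) (after j u)
    have hX := prob_jointLaw_comp_fst W p (after j) (after j (assemble u))
    have hYU := prob_jointLaw_comp_pair W assemble (piPMF fun k => piPMF (κ k)) (fun y => y j)
      (after j) (y j) (after j u)
    have hYX := prob_jointLaw_comp_pair W id p (fun y => y j) (after j) (y j)
      (after j (assemble u))
    have hpU := prob_pos (piPMF fun k => piPMF (κ k)) (after j) hu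
    have hpX := prob_pos p (after j) hx
    simp only [id] at hYX
    rw [condProb, condProb, hU, hX, hYU, hYX, div_eq_div_iff hpU.ne' hpX.ne', Finset.sum_mul,
      Finset.sum_mul]
    refine Finset.sum_congr rfl fun x _ => ?_
    linear_combination prob (W x) (fun y => y j) (y j) * prob_assemble_after_mul hκ x u j

lemma exists_independent_letters {X : Fin (K + 1) → Type u} [∀ k, Fintype (X k)]
    [∀ k, Fintype (Y k)] (W : (∀ k, X k) → PMF (∀ k, Y k)) (p : PMF (∀ k, X k)) :
    ∃ (U : Fin (K + 1) → Type u) (_ : ∀ k, Fintype (U k)) (π : ∀ k, PMF (U k))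
      (φ : (∀ k, U k) → ∀ k, X k),
      (∀ k, DependsOn (fun u => φ u k) (Set.Ici k)) ∧
      ∀ j, cutInfo (fun u => W (φ u)) (piPMF π) j = cutInfo W p j := by
  have := fun k => Classical.decEq (X k)
  choose κ hκ using fun k => exists_pmf_mul_prob_eq p (fun x => x k) (after k)
  refine ⟨Letter X, fun k => inferInstance, fun k => piPMF (κ k), assemble,
    fun k u u' h => assemble_congr h, fun j => ?_⟩
  let P := piPMF fun k => piPMF (κ k)
  let density (x : ∀ k, X k) : ℝ := ∑ y, (W x y).toReal * cutDensity W p j (x, y)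
  calc _ = ∑ u, (P u).toReal * density (assemble u) := by
        rw [cutInfo_eq_sum, Fintype.sum_prod_type]
        refine Finset.sum_congr rfl fun u _ => ?_
        rw [Finset.mul_sum]
        refine Finset.sum_congr rfl fun y _ => ?_
        rw [toReal_jointLaw_apply, mul_assoc]
        rcases (ENNReal.toReal_nonneg (a := P u)).eq_or_lt with hu | hu
        · rw [← hu, zero_mul, zero_mul]
        · exact congrArg (fun d => (P u).toReal * ((W (assemble u) y).toReal * d))
            (cutDensity_assemble W hκ j hu y)
    _ = ∑ x, (p x).toReal * density x := by
        rw [← sum_prob_mul P assemble]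
        exact Finset.sum_congr rfl fun x _ => congrArg (· * _) (prob_assemble hκ x)
    _ = cutInfo W p j := by
        simp only [cutInfo_eq_sum, Fintype.sum_prod_type, toReal_jointLaw_apply, density,
          Finset.mul_sum, mul_assoc]

end FunctionalRepresentation

section LetterDensity

variable {K : ℕ} {U Y : Fin (K + 1) → Type*} (V : (∀ k, U k) → PMF (∀ k, Y k))
  (P : PMF (∀ k, U k)) (j k : Fin (K + 1))

/-- The density of the information that the output `Y_j` carries about the letter `U_k` when the
later letters are known. -/
def letterDensity (u : ∀ k, U k) (b : Y j) : ℝ :=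
  condProb (jointLaw V P) (fun ω => ω.2 j) (fun ω => tailFrom k ω.1) b (tailFrom k u) /
    condProb (jointLaw V P) (fun ω => ω.2 j) (fun ω => after k ω.1) b (after k u)

lemma letterDensity_nonneg (u : ∀ k, U k) (b : Y j) : 0 ≤ letterDensity V P j k u b :=
  div_nonneg (condProb_nonneg _ _ _ _ _) (condProb_nonneg _ _ _ _ _)

variable {V P} in
lemma letterDensity_pos {ω : (∀ k, U k) × (∀ k, Y k)} (hω : 0 < (jointLaw V P ω).toReal) :
    0 < letterDensity V P j k ω.1 (ω.2 j) := by
  have htail := condProb_pos (jointLaw V P) (fun ω => ω.2 j) (fun ω => tailFrom k ω.1) hω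
  have hafter := condProb_pos (jointLaw V P) (fun ω => ω.2 j) (fun ω => after k ω.1) hω
  exact div_pos htail hafter

variable {j k} in
lemma letterDensity_congr {u u' : ∀ k, U k} (h : ∀ i, k ≤ i → u i = u' i) (b : Y j) :
    letterDensity V P j k u b = letterDensity V P j k u' b := by
  have hafter : after k u = after k u' := funext fun i => h i i.2.le
  rw [letterDensity, letterDensity, tailFrom, tailFrom, hafter, h k le_rfl]

variable {V P} in
lemma sum_log_letterDensity {ω : (∀ k, U k) × (∀ k, Y k)} (hω : 0 < (jointLaw V P ω).toReal) :
    ∑ k ∈ Finset.Iic j, Real.log (letterDensity V P j k ω.1 (ω.2 j)) = cutDensity V P j ω := by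
  have hafter (k) := condProb_pos (jointLaw V P) (fun ω => ω.2 j) (fun ω => after k ω.1) hω
  rw [← Real.log_prod fun k _ => (letterDensity_pos j k hω).ne', cutDensity,
    ← condProb_comp_of_injective _ _ Prod.fst tailFrom_zero_injective]
  congr 1
  rw [eq_div_iff (hafter j).ne']
  refine prod_Iic_mul_of_telescope
    (T := fun k => condProb (jointLaw V P) (fun ω => ω.2 j) (fun ω => tailFrom k ω.1) (ω.2 j)
      (tailFrom k ω.1))
    (A := fun k => condProb (jointLaw V P) (fun ω => ω.2 j) (fun ω => after k ω.1) (ω.2 j)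
      (after k ω.1))
    (fun k => div_mul_cancel₀ _ (hafter k).ne')
    (fun i => condProb_congr_right _ _ _ _ ?_ _) j
  exact congrArg (Prod.fst ⁻¹' ·) (tailFrom_succ_preimage i ω.1)

variable [∀ k, Fintype (U k)] [∀ k, Fintype (Y k)]

lemma sum_sum_log_letterDensity : ∑ k ∈ Finset.Iic j, ∑ ω, (jointLaw V P ω).toReal *
    Real.log (letterDensity V P j k ω.1 (ω.2 j)) = cutInfo V P j := by
  rw [Finset.sum_comm, cutInfo_eq_sum]
  refine Finset.sum_congr rfl fun ω _ => ?_
  rw [← Finset.mul_sum]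
  rcases ENNReal.toReal_nonneg (a := jointLaw V P ω) |>.eq_or_lt with hω | hω
  · rw [← hω, zero_mul, zero_mul]
  · rw [sum_log_letterDensity j hω]

lemma sum_mul_letterDensity_update_le_one (π : PMF (U k)) :
    ∑ ω, (jointLaw V P ω).toReal *
      ∑ a, (π a).toReal * letterDensity V P j k (Function.update ω.1 k a) (ω.2 j) ≤ 1 := by
  set ν := jointLaw V P
  let Yj (ω : (∀ k, U k) × (∀ k, Y k)) : Y j := ω.2 j
  let tail (ω : (∀ k, U k) × (∀ k, Y k)) := tailFrom k ω.1
  let rest (ω : (∀ k, U k) × (∀ k, Y k)) := after k ω.1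
  have hdensity (ω) (a) : letterDensity V P j k (Function.update ω.1 k a) (ω.2 j) =
      condProb ν Yj tail (Yj ω) (a, rest ω) / condProb ν Yj rest (Yj ω) (rest ω) := by
    have hafter : after k (Function.update ω.1 k a) = rest ω :=
      funext fun i => Function.update_of_ne i.2.ne' _ _
    rw [letterDensity, tailFrom, hafter, Function.update_self]
  calc _ = ∑ z : Y j × _, prob ν (fun ω => (Yj ω, rest ω)) z *
        ∑ a, (π a).toReal * (condProb ν Yj tail z.1 (a, z.2) / condProb ν Yj rest z.1 z.2) := by
        rw [sum_prob_mul]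
        simp only [hdensity]
    _ = ∑ c, prob ν rest c * ∑ a, (π a).toReal * ∑ b, condProb ν Yj tail b (a, c) *
        (condProb ν Yj rest b c / condProb ν Yj rest b c) := by
        simp only [Fintype.sum_prod_type_right, ← condProb_mul_prob, Finset.mul_sum]
        refine Finset.sum_congr rfl fun c _ => Finset.sum_comm.trans ?_
        refine Finset.sum_congr rfl fun a _ => Finset.sum_congr rfl fun b _ => by ring
    _ ≤ ∑ c, prob ν rest c * ∑ a, (π a).toReal * 1 := by
        gcongr with c _ a _
        · exact prob_nonneg _ _ _
        · refine (Finset.sum_le_sum fun b _ => ?_).trans (sum_condProb_le_one ν Yj tail (a, c))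
          exact mul_le_of_le_one_right (condProb_nonneg _ _ _ _ _) (div_self_le_one _)
    _ = 1 := by simp only [mul_one, sum_toReal_eq_one, sum_prob]

end LetterDensity

section NegativeMoment

lemma eventually_sum_rpow_neg_le {Ω : Type*} [Fintype Ω] (μ : PMF Ω) {f : Ω → ℝ}
    (hf : ∀ ω, 0 < (μ ω).toReal → 0 < f ω) {ε : ℝ} (hε : 0 < ε) :
    ∀ᶠ l in 𝓝[>] (0 : ℝ), ∑ ω, (μ ω).toReal * f ω ^ (-l) ≤
      Real.exp (-l * (∑ ω, (μ ω).toReal * Real.log (f ω) - ε)) := by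
  set I := ∑ ω, (μ ω).toReal * Real.log (f ω)
  have hderiv :
      HasDerivAt (fun l => ∑ ω, (μ ω).toReal * Real.exp (-l * Real.log (f ω))) (-I) 0 := by
    have h := HasDerivAt.fun_sum fun ω (_ : ω ∈ Finset.univ) =>
      (((hasDerivAt_neg (0 : ℝ)).mul_const (Real.log (f ω))).exp).const_mul (μ ω).toReal
    simpa [I] using h
  have hslope := hderiv.tendsto_slope_zero_right.eventually_lt_const (by linarith : -I < -I + ε)
  filter_upwards [hslope, self_mem_nhdsWithin] with l hl hl₀
  have hl₀ : 0 < l := hl₀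
  simp only [zero_add, neg_zero, zero_mul, Real.exp_zero, mul_one, sum_toReal_eq_one,
    smul_eq_mul] at hl
  rw [inv_mul_lt_iff₀ hl₀] at hl
  calc ∑ ω, (μ ω).toReal * f ω ^ (-l)
      = ∑ ω, (μ ω).toReal * Real.exp (-l * Real.log (f ω)) := by
        refine Finset.sum_congr rfl fun ω _ => ?_
        rcases ENNReal.toReal_nonneg (a := μ ω) |>.eq_or_lt with hω | hω
        · rw [← hω, zero_mul, zero_mul]
        · rw [Real.rpow_def_of_pos (hf ω hω), mul_comm (Real.log (f ω))]
    _ ≤ -l * (I - ε) + 1 := by linarith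
    _ ≤ Real.exp (-l * (I - ε)) := Real.add_one_le_exp _

variable {K : ℕ} {U Y : Fin (K + 1) → Type*} [∀ k, Fintype (U k)] [∀ k, Fintype (Y k)]
  (V : (∀ k, U k) → PMF (∀ k, Y k)) (P : PMF (∀ k, U k)) (j : Fin (K + 1))

/-- The moment of order `-l` of the density of the letter `U_k` at the output `Y_j`. -/
def letterMoment (k : Fin (K + 1)) (l : ℝ) : ℝ :=
  ∑ ω, (jointLaw V P ω).toReal * letterDensity V P j k ω.1 (ω.2 j) ^ (-l)

lemma letterMoment_nonneg (k : Fin (K + 1)) (l : ℝ) : 0 ≤ letterMoment V P j k l :=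
  Finset.sum_nonneg fun _ _ => mul_nonneg ENNReal.toReal_nonneg
    (Real.rpow_nonneg (letterDensity_nonneg V P j k _ _) _)

lemma eventually_prod_letterMoment_le {ε : ℝ} (hε : 0 < ε) :
    ∀ᶠ l in 𝓝[>] (0 : ℝ), ∏ k ∈ Finset.Iic j, letterMoment V P j k l ≤
      Real.exp (-l * (cutInfo V P j - ε)) := by
  have hmoment (k : Fin (K + 1)) := eventually_sum_rpow_neg_le (jointLaw V P)
    (fun _ => letterDensity_pos j k) (by positivity : 0 < ε / (j + 1))
  filter_upwards [eventually_all.2 hmoment] with l hl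
  calc _ ≤ ∏ k ∈ Finset.Iic j, Real.exp (-l * (∑ ω, (jointLaw V P ω).toReal *
        Real.log (letterDensity V P j k ω.1 (ω.2 j)) - ε / (j + 1))) :=
        Finset.prod_le_prod (fun k _ => letterMoment_nonneg V P j k l) fun k _ => hl k
    _ = _ := by
        rw [← Real.exp_sum, ← Finset.mul_sum, Finset.sum_sub_distrib, sum_sum_log_letterDensity,
          Finset.sum_const, Fin.card_Iic, nsmul_eq_mul, Nat.cast_add_one,
          mul_div_cancel₀ _ (by positivity)]

end NegativeMoment

section Threshold

lemma exists_le_of_sum_mul_le {Ω : Type*} [Fintype Ω] (μ : PMF Ω) {f : Ω → ℝ} {b : ℝ}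
    (h : ∑ ω, (μ ω).toReal * f ω ≤ b) : ∃ ω, f ω ≤ b := by
  by_contra! hb
  have hweight : ∃ ω ∈ Finset.univ, (μ ω).toReal ≠ 0 := by
    refine Finset.exists_ne_zero_of_sum_ne_zero ?_
    rw [sum_toReal_eq_one]
    exact one_ne_zero
  obtain ⟨ω, -, hω⟩ := hweight
  have hlt : ∑ ω, (μ ω).toReal * b < ∑ ω, (μ ω).toReal * f ω :=
    Finset.sum_lt_sum (fun ω _ => mul_le_mul_of_nonneg_left (hb ω).le ENNReal.toReal_nonneg)
      ⟨ω, Finset.mem_univ ω,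
        mul_lt_mul_of_pos_left (hb ω) (ENNReal.toReal_nonneg.lt_of_ne' hω)⟩
  rw [← Finset.sum_mul, sum_toReal_eq_one, one_mul] at hlt
  exact hlt.not_ge h

/-- The message `m₀` is the only one which passes the test `T`. -/
def Identifies {M : Type*} (T : M → Prop) (m₀ : M) : Prop :=
  ∀ m, T m ↔ m = m₀

open scoped Classical in
/-- Markov's inequality for the metric of the true message, raised to a negative power, and the
union bound with Markov's inequality for the metrics of the other messages. -/
lemma sum_not_identifies_le {Ω M : Type*} [Fintype Ω] [Fintype M] [DecidableEq M]
    (μ : PMF Ω) (m₀ : M) {f : M → Ω → ℝ} (hf : ∀ m ω, 0 ≤ f m ω)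
    (hf₀ : ∀ ω, 0 < (μ ω).toReal → 0 < f m₀ ω) {θ l : ℝ} (hθ : 0 < θ) (hl : 0 < l) :
    ∑ ω, (μ ω).toReal * (if Identifies (fun m => θ ≤ f m ω) m₀ then 0 else 1) ≤
      θ ^ l * ∑ ω, (μ ω).toReal * f m₀ ω ^ (-l) +
        θ⁻¹ * ∑ m with m ≠ m₀, ∑ ω, (μ ω).toReal * f m ω := by
  have hpoint (ω) (hω : 0 < (μ ω).toReal) :
      (if Identifies (fun m => θ ≤ f m ω) m₀ then (0 : ℝ) else 1) ≤
        θ ^ l * f m₀ ω ^ (-l) + θ⁻¹ * ∑ m with m ≠ m₀, f m ω := by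
    have hpos := hf₀ ω hω
    have hsum : 0 ≤ ∑ m with m ≠ m₀, f m ω := Finset.sum_nonneg fun m _ => hf m ω
    split_ifs with h
    · positivity
    obtain ⟨m, hm⟩ := not_forall.1 h
    rcases eq_or_ne m m₀ with rfl | hne
    · have hlt : f m ω < θ := by simpa using hm
      have hone : 1 ≤ θ ^ l * f m ω ^ (-l) := by
        rw [Real.rpow_neg hpos.le, ← div_eq_mul_inv, ← Real.div_rpow hθ.le hpos.le]
        exact Real.one_le_rpow ((one_le_div hpos).2 hlt.le) hl.le
      exact hone.trans (le_add_of_nonneg_right (by positivity))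
    · have hle : θ ≤ f m ω := by simpa [hne] using hm
      have hone : 1 ≤ θ⁻¹ * ∑ m with m ≠ m₀, f m ω := by
        rw [← div_eq_inv_mul, one_le_div hθ]
        exact hle.trans (Finset.single_le_sum (fun m _ => hf m ω) (by simpa using hne))
      exact hone.trans (le_add_of_nonneg_left (by positivity))
  calc _ ≤ ∑ ω, (μ ω).toReal * (θ ^ l * f m₀ ω ^ (-l) + θ⁻¹ * ∑ m with m ≠ m₀, f m ω) := by
        refine Finset.sum_le_sum fun ω _ => ?_
        rcases ENNReal.toReal_nonneg (a := μ ω) |>.eq_or_lt with hω | hω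
        · rw [← hω, zero_mul, zero_mul]
        · exact mul_le_mul_of_nonneg_left (hpoint ω hω) hω.le
    _ = _ := by
        rw [Finset.sum_comm' (t' := Finset.univ) (s' := fun _ => Finset.univ.filter (· ≠ m₀))
          (by simp)]
        simp only [mul_add, Finset.sum_add_distrib, Finset.mul_sum, mul_left_comm]

end Threshold

section Slot

variable {K : ℕ} {U Y : Fin (K + 1) → Type*} {M : Type*} [∀ k, Fintype (U k)]
  [Fintype M] [DecidableEq M] (V : (∀ k, U k) → PMF (∀ k, Y k)) (π : ∀ k, PMF (U k))

/-- The letters by which the book `c` of one channel use represents the messages `w k` of the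
terminals `T_k`. -/
def select (c : ∀ i : Fin (K + 1) × M, U i.1) (w : Fin (K + 1) → M) : ∀ k, U k :=
  fun k => c (k, w k)

/-- The joint law of a book of independent letters and the channel outputs in one channel use in
which the letters of the messages `w` are sent. -/
def slotLaw (w : Fin (K + 1) → M) : PMF ((∀ i : Fin (K + 1) × M, U i.1) × (∀ k, Y k)) :=
  (piPMF fun i : Fin (K + 1) × M => π i.1).bind fun c => (V (select c w)).map (Prod.mk c)

lemma toReal_slotLaw_apply (w : Fin (K + 1) → M) (c : ∀ i : Fin (K + 1) × M, U i.1)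
    (y : ∀ k, Y k) : (slotLaw V π w (c, y)).toReal =
      (piPMF (fun i : Fin (K + 1) × M => π i.1) c).toReal * (V (select c w) y).toReal :=
  toReal_bind_map_mk_apply _ _ c y

lemma map_slotLaw (w : Fin (K + 1) → M) :
    (slotLaw V π w).map (fun z => (select z.1 w, z.2)) = jointLaw V (piPMF π) := by
  have hinj : Function.Injective fun k => (k, w k) := fun k k' h => (Prod.mk.inj h).1
  rw [slotLaw, PMF.map_bind, jointLaw, ← map_piPMF_comp (fun i : Fin (K + 1) × M => π i.1) hinj,
    PMF.bind_map]
  simp only [PMF.map_comp]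
  rfl

lemma letterDensity_select_pos (j k : Fin (K + 1)) {w : Fin (K + 1) → M}
    {z : (∀ i : Fin (K + 1) × M, U i.1) × (∀ k, Y k)} (hz : 0 < (slotLaw V π w z).toReal) :
    0 < letterDensity V (piPMF π) j k (select z.1 w) (z.2 j) := by
  refine letterDensity_pos (ω := (select z.1 w, z.2)) j k ?_
  rw [← map_slotLaw V π w]
  exact prob_pos (slotLaw V π w) (fun z => (select z.1 w, z.2)) hz

variable [∀ k, Fintype (Y k)]

lemma sum_slotLaw_mul (w : Fin (K + 1) → M) (F : (∀ k, U k) × (∀ k, Y k) → ℝ) :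
    ∑ z, (slotLaw V π w z).toReal * F (select z.1 w, z.2) =
      ∑ ω, (jointLaw V (piPMF π) ω).toReal * F ω := by
  rw [← map_slotLaw V π w]
  exact (sum_prob_mul (slotLaw V π w) (fun z => (select z.1 w, z.2)) F).symm

lemma sum_slotLaw_mul_letterDensity_update_le_one (j k : Fin (K + 1)) {w : Fin (K + 1) → M}
    {m : M} (hm : m ≠ w k) : ∑ z, (slotLaw V π w z).toReal *
      letterDensity V (piPMF π) j k (select z.1 (Function.update w k m)) (z.2 j) ≤ 1 := by
  have hresample (c : ∀ i : Fin (K + 1) × M, U i.1) (a : U k) :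
      select (Function.update c (k, m) a) w = select c w :=
    funext fun i => Function.update_of_ne (fun h => by
      obtain ⟨rfl, rfl⟩ := Prod.mk.inj h
      exact hm rfl) _ _
  have hselect (c : ∀ i : Fin (K + 1) × M, U i.1) (a : U k) :
      select (Function.update c (k, m) a) (Function.update w k m) =
        Function.update (select c w) k a := by
    funext i
    rcases eq_or_ne i k with rfl | hi
    · rw [select, Function.update_self, Function.update_self, Function.update_self]
    · rw [Function.update_of_ne hi, ← hresample c a, select, select, Function.update_of_ne hi]
  have hswap := sum_piPMF_mul_sum_update (fun i : Fin (K + 1) × M => π i.1) (k, m) fun c =>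
    ∑ y, (V (select c w) y).toReal *
      letterDensity V (piPMF π) j k (select c (Function.update w k m)) (y j)
  simp only [hresample, hselect] at hswap
  refine le_trans (le_of_eq ?_) (sum_mul_letterDensity_update_le_one V (piPMF π) j k (π k))
  rw [← sum_slotLaw_mul V π w]
  simp only [Fintype.sum_prod_type, toReal_slotLaw_apply, mul_assoc, ← Finset.mul_sum]
  rw [← hswap]
  refine Finset.sum_congr rfl fun c _ => congrArg _ ?_
  simp only [Finset.mul_sum]
  rw [Finset.sum_comm]
  simp only [mul_left_comm]

end Slot

section Window

variable {K : ℕ} {U Y : Fin (K + 1) → Type*} {M J : Type*} [∀ k, Fintype (U k)] [Fintype J]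
  (V : (∀ k, U k) → PMF (∀ k, Y k)) (π : ∀ k, PMF (U k)) (j : Fin (K + 1))
  (level : J → Fin (K + 1)) (w : J → Fin (K + 1) → M)

/-- The product of the densities, at the output `Y_j`, of the letters at the positions `level i`
of the channel uses `i`, when the messages in these channel uses are `w i`. -/
def windowDensity (C : J → ∀ i : Fin (K + 1) × M, U i.1) (y : J → Y j) : ℝ :=
  ∏ i, letterDensity V (piPMF π) j (level i) (select (C i) (w i)) (y i)

lemma windowDensity_nonneg (C : J → ∀ i : Fin (K + 1) × M, U i.1) (y : J → Y j) :
    0 ≤ windowDensity V π j level w C y :=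
  Finset.prod_nonneg fun _ _ => letterDensity_nonneg _ _ _ _ _ _

variable [DecidableEq M]

/-- The metric by which the message `m` is decoded from the channel uses in a window, in which it is
represented by the letters at the positions `level i`. -/
def metric (score : M → ℝ) (m : M) (C : J → ∀ i : Fin (K + 1) × M, U i.1) (y : J → Y j) : ℝ :=
  score m * windowDensity V π j level (fun i => Function.update (w i) (level i) m) C y

variable [Fintype M] [DecidableEq J] [∀ k, Fintype (Y k)]

lemma windowDensity_pos {z : J → (∀ i : Fin (K + 1) × M, U i.1) × (∀ k, Y k)}
    (hz : 0 < (piPMF (fun i => slotLaw V π (w i)) z).toReal) :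
    0 < windowDensity V π j level w (fun i => (z i).1) (fun i => (z i).2 j) :=
  Finset.prod_pos fun i _ =>
    letterDensity_select_pos V π j (level i) (toReal_pos_of_piPMF_pos hz i)

lemma sum_mul_windowDensity_rpow (l : ℝ) :
    ∑ z, (piPMF (fun i => slotLaw V π (w i)) z).toReal *
      windowDensity V π j level w (fun i => (z i).1) (fun i => (z i).2 j) ^ (-l) =
        ∏ i, letterMoment V (piPMF π) j (level i) l := by
  simp only [windowDensity, ← Real.finsetProd_rpow _ _ fun i _ =>
    letterDensity_nonneg V (piPMF π) j (level i) _ _]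
  rw [sum_piPMF_mul_prod (fun i => slotLaw V π (w i)) fun i z =>
    letterDensity V (piPMF π) j (level i) (select z.1 (w i)) (z.2 j) ^ (-l)]
  exact Finset.prod_congr rfl fun i _ => sum_slotLaw_mul V π (w i) fun ω =>
    letterDensity V (piPMF π) j (level i) ω.1 (ω.2 j) ^ (-l)

lemma sum_mul_windowDensity_update_le_one {m : M} (hm : ∀ i, m ≠ w i (level i)) :
    ∑ z, (piPMF (fun i => slotLaw V π (w i)) z).toReal *
      windowDensity V π j level (fun i => Function.update (w i) (level i) m) (fun i => (z i).1)
        (fun i => (z i).2 j) ≤ 1 := by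
  simp only [windowDensity]
  rw [sum_piPMF_mul_prod (fun i => slotLaw V π (w i)) fun i z => letterDensity V (piPMF π) j
    (level i) (select z.1 (Function.update (w i) (level i) m)) (z.2 j)]
  refine Finset.prod_le_one (fun i _ => Finset.sum_nonneg fun z _ => ?_) fun i _ =>
    sum_slotLaw_mul_letterDensity_update_le_one V π j (level i) (hm i)
  exact mul_nonneg ENNReal.toReal_nonneg (letterDensity_nonneg _ _ _ _ _ _)

open scoped Classical in
lemma sum_not_identifies_metric_le {score : M → ℝ} (hscore : ∀ m, 0 ≤ score m)
    (hscore_sum : ∑ m, score m ≤ 1) {m₀ : M} (hm₀ : 0 < score m₀) (hw : ∀ i, w i (level i) = m₀)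
    {θ l : ℝ} (hθ : 0 < θ) (hl : 0 < l) :
    ∑ z, (piPMF (fun i => slotLaw V π (w i)) z).toReal *
      (if Identifies (fun m => θ ≤ metric V π j level w score m (fun i => (z i).1)
        fun i => (z i).2 j) m₀ then 0 else 1) ≤
      θ ^ l * (score m₀ ^ (-l) * ∏ i, letterMoment V (piPMF π) j (level i) l) + θ⁻¹ := by
  set ν := piPMF fun i => slotLaw V π (w i)
  have htrue (C : J → ∀ i : Fin (K + 1) × M, U i.1) (y : J → Y j) :
      metric V π j level w score m₀ C y = score m₀ * windowDensity V π j level w C y := by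
    have hupdate : (fun i => Function.update (w i) (level i) m₀) = w :=
      funext fun i => by rw [← hw i, Function.update_eq_self]
    rw [metric, hupdate]
  have hmarkov := sum_not_identifies_le ν m₀ (f := fun m z => metric V π j level w score m
    (fun i => (z i).1) fun i => (z i).2 j)
    (fun m z => mul_nonneg (hscore m) (windowDensity_nonneg _ _ _ _ _ _ _))
    (fun z hz => (mul_pos hm₀ (windowDensity_pos V π j level w hz)).trans_eq (htrue _ _).symm)
    hθ hl
  refine hmarkov.trans (add_le_add (le_of_eq ?_) (mul_le_of_le_one_right (by positivity) ?_))
  · simp only [htrue, Real.mul_rpow hm₀.le (windowDensity_nonneg _ _ _ _ _ _ _), mul_left_comm,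
      ← Finset.mul_sum, ν, sum_mul_windowDensity_rpow]
  · refine (Finset.sum_le_sum fun m hm => ?_).trans <|
      (Finset.sum_le_sum_of_subset_of_nonneg (Finset.filter_subset _ Finset.univ)
        fun m _ _ => hscore m).trans hscore_sum
    simp only [metric, mul_left_comm _ (score m), ← Finset.mul_sum]
    refine mul_le_of_le_one_right (hscore m)
      (sum_mul_windowDensity_update_le_one V π j level w fun i => ?_)
    rw [hw]
    exact (Finset.mem_filter.1 hm).2

end Window

section Block

/-- The message with index `e` in a sequence of `B` messages of length `m`, which have the indices
`K, …, K + B - 1`. The messages with other indices are constant and known to all terminals. -/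
def block {A : Type*} [Nonempty A] (K : ℕ) {B m : ℕ} (f : Fin (B * m) → A) (e : ℕ) : Fin m → A :=
  if h : K ≤ e ∧ e < K + B then fun k => f (finProdFinEquiv (⟨e - K, by lia⟩, k))
  else fun _ => Classical.arbitrary A

variable {A : Type*} [Nonempty A] {K B m : ℕ} (f : Fin (B * m) → A)

lemma block_add (b : Fin B) : block K f (K + b) = fun k => f (finProdFinEquiv (b, k)) := by
  rw [block, dif_pos (by lia)]
  simp only [Nat.add_sub_cancel_left]

lemma block_of_not {e : ℕ} (h : ¬(K ≤ e ∧ e < K + B)) :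
    block K f e = fun _ => Classical.arbitrary A :=
  dif_neg h

end Block

section Estimate

variable {M : Type*} [Nonempty M]

/-- The successive decisions by the tests `T e`: after `e` steps, the messages with index below `e`
have been decided, each on the basis of the earlier decisions. -/
def estimate (T : ℕ → (ℕ → M) → Prop) : ℕ → ℕ → M
  | 0 => fun _ => Classical.arbitrary M
  | e + 1 => Function.update (estimate T e) e
      (Classical.epsilon fun m => T e (Function.update (estimate T e) e m))

variable {T T' : ℕ → (ℕ → M) → Prop} {e : ℕ}

lemma estimate_congr (h : ∀ e' < e, T e' = T' e') : estimate T e = estimate T' e := by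
  induction e with
  | zero => rfl
  | succ e ih =>
    rw [estimate, estimate, ih fun e' he' => h e' (he'.trans e.lt_succ_self), h e e.lt_succ_self]

lemma estimate_eq_of_lt {w : ℕ → M}
    (hT : ∀ e w w', (∀ e' ≤ e, w e' = w' e') → (T e w ↔ T e w'))
    (hw : ∀ e, Identifies (fun m => T e (Function.update w e m)) (w e)) {e' : ℕ} (he : e' < e) :
    estimate T e e' = w e' := by
  induction e generalizing e' with
  | zero => exact absurd he e'.not_lt_zero
  | succ e ih =>
    rw [estimate]
    rcases (Nat.lt_succ_iff.1 he).eq_or_lt with rfl | he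
    · have hagree (m) : T e' (Function.update (estimate T e') e' m) ↔ m = w e' := by
        refine (hT e' _ _ fun i hi => ?_).trans (hw e' m)
        rcases hi.eq_or_lt with rfl | hi
        · rw [Function.update_self, Function.update_self]
        · rw [Function.update_of_ne hi.ne, Function.update_of_ne hi.ne, ih hi]
      rw [Function.update_self]
      exact (hagree _).1 (Classical.epsilon_spec
        (p := fun m => T e' (Function.update (estimate T e') e' m)) ⟨w e', (hagree _).2 rfl⟩)
    · rw [Function.update_of_ne he.ne, ih he]

end Estimate

section GenieAided

variable {K : ℕ} {X Y : Fin (K + 1) → Type*} {S : Fin (K + 2) → Type*} {m n : ℕ}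
  [∀ j, Fintype (Y j)] [∀ i, Fintype (S i)] [Nonempty (∀ j, Y j)]

lemma Code.errorProb_le_of_input_eq (c : Code X Y S m n) (W : (∀ j, X j) → PMF (∀ j, Y j))
    (q : PMF (∀ i, S i)) {Good : (Fin m → ∀ i, S i) → (Fin n → ∀ j, Y j) → Prop}
    [∀ s y, Decidable (Good s y)]
    {x : (Fin m → ∀ i, S i) → Fin n → ∀ j, X j}
    (hinput : ∀ s y, Good s y → ∀ t, c.input s y t = x s t)
    (hcorrect : ∀ s y, Good s y → c.Correct s y) :
    c.errorProb W q ≤ ∑ s, (piPMF (fun _ : Fin m => q) s).toReal *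
      ∑ y, (piPMF (fun t => W (x s t)) y).toReal * if Good s y then 0 else 1 := by
  let ideal (s : Fin m → ∀ i, S i) (y : Fin n → ∀ j, Y j) : ℝ :=
    (piPMF (fun _ : Fin m => q) s).toReal * (piPMF (fun t => W (x s t)) y).toReal
  have hlaw (s y) (h : Good s y) : c.law W q s y = ideal s y := by
    simp only [ideal, Code.law, feedbackLaw, toReal_piPMF_apply, hinput s y h]
  have hideal : ∑ s, ∑ y, ideal s y = 1 := by
    simp only [ideal, ← Finset.mul_sum, sum_toReal_eq_one, mul_one]
  have hgood : ∑ s, ∑ y, (if Good s y then c.law W q s y else 0) =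
      ∑ s, ∑ y, if Good s y then ideal s y else 0 := by
    refine Finset.sum_congr rfl fun s _ => Finset.sum_congr rfl fun y _ => ?_
    split_ifs with h
    exacts [hlaw s y h, rfl]
  have hsplit (F : (Fin m → ∀ i, S i) → (Fin n → ∀ j, Y j) → ℝ) : ∑ s, ∑ y, F s y =
      ∑ s, ∑ y, (if Good s y then F s y else 0) + ∑ s, ∑ y, if Good s y then 0 else F s y := by
    simp only [← Finset.sum_add_distrib]
    refine Finset.sum_congr rfl fun s _ => Finset.sum_congr rfl fun y _ => ?_
    split_ifs <;> simp
  calc c.errorProb W q ≤ ∑ s, ∑ y, if Good s y then 0 else c.law W q s y := by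
        rw [c.errorProb_eq_sum]
        refine Finset.sum_le_sum fun s _ => Finset.sum_le_sum fun y _ => ?_
        by_cases h : Good s y
        · rw [if_pos h, if_pos (hcorrect s y h)]
        · rw [if_neg h]
          split_ifs
          exacts [c.law_nonneg W q s y, le_rfl]
    _ = ∑ s, ∑ y, if Good s y then 0 else ideal s y := by
        linarith [hsplit (c.law W q), hsplit ideal, c.sum_sum_law_eq_one W q]
    _ = _ := by simp only [ideal, Finset.mul_sum, mul_ite, mul_zero, mul_one]

end GenieAided

section BlockScheme

lemma ite_forall_le_sum {ι : Type*} [Fintype ι] (p : ι → Prop) [DecidablePred p]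
    [Decidable (∀ i, p i)] : (if ∀ i, p i then (0 : ℝ) else 1) ≤ ∑ i, if p i then 0 else 1 := by
  have hnonneg (i) : (0 : ℝ) ≤ if p i then 0 else 1 := by split_ifs <;> simp
  split_ifs with h
  · exact Finset.sum_nonneg fun i _ => hnonneg i
  · obtain ⟨i, hi⟩ := not_forall.1 h
    exact (if_neg hi).symm.trans_le
      (Finset.single_le_sum (fun i _ => hnonneg i) (Finset.mem_univ i))

lemma finProdFinEquiv_lt {a b : ℕ} {τ : Fin a × Fin b} {t : Fin (a * b)}
    (h : τ.1 < (finProdFinEquiv.symm t).1) : finProdFinEquiv τ < t := by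
  rw [← finProdFinEquiv.apply_symm_apply t, Fin.lt_def]
  simp only [finProdFinEquiv_apply_val]
  have hmul := Nat.mul_le_mul_left b (Nat.succ_le_of_lt (Fin.lt_def.1 h))
  have hτ := τ.2.isLt
  rw [Nat.mul_succ] at hmul
  lia

/-- A block Markov scheme: `B` messages of length `m` are sent in `B + K` blocks of `n` channel
uses. The message with index `K + b`, `b < B`, reaches the input of the terminal `T_k` in the block
`b + k`, and is decided from the output `Y_j` at the end of the block `b + j`, by a test on the
messages with indices up to `K + b`. -/
structure BlockScheme {K : ℕ} (X Y : Fin (K + 1) → Type*) (S : Fin (K + 2) → Type*)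
    (B m n : ℕ) where
  input : (ℕ → Fin m → S 0) → Fin (B + K) × Fin n → ∀ k, X k
  input_congr : ∀ {w w' τ} {k : Fin (K + 1)}, (∀ e, e + k ≤ τ.1 + K → w e = w' e) →
    input w τ k = input w' τ k
  test : ∀ j : Fin (K + 1), (Fin (B + K) × Fin n → Y j) → (Fin m → S j.succ) → Fin B →
    (ℕ → Fin m → S 0) → Prop
  test_congr : ∀ {j : Fin (K + 1)} {y y' σ} {b : Fin B} {w w'},
    (∀ τ, (τ.1 : ℕ) ≤ b + j → y τ = y' τ) → (∀ e ≤ K + b, w e = w' e) →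
      (test j y σ b w ↔ test j y' σ b w')

namespace BlockScheme

variable {K B m n : ℕ} {X Y : Fin (K + 1) → Type*} {S : Fin (K + 2) → Type*}
  (𝒞 : BlockScheme X Y S B m n) [∀ i, Nonempty (S i)] (j : Fin (K + 1))

/-- The test used for the decision on the message with index `e`: the messages which do not
belong to the sequence are known. -/
def fullTest (y : Fin (B + K) × Fin n → Y j) (σ : Fin (B * m) → S j.succ) (e : ℕ)
    (w : ℕ → Fin m → S 0) : Prop :=
  if h : K ≤ e ∧ e < K + B then 𝒞.test j y (block K σ e) ⟨e - K, by lia⟩ w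
  else w e = fun _ => Classical.arbitrary _

variable {j} in
lemma fullTest_congr {y y' : Fin (B + K) × Fin n → Y j} {σ : Fin (B * m) → S j.succ} {e : ℕ}
    {w w' : ℕ → Fin m → S 0} (hy : ∀ τ, τ.1 + K ≤ e + j → y τ = y' τ)
    (hw : ∀ e' ≤ e, w e' = w' e') : 𝒞.fullTest j y σ e w ↔ 𝒞.fullTest j y' σ e w' := by
  unfold fullTest
  split_ifs with h
  · exact 𝒞.test_congr (fun τ hτ => hy τ (by lia)) fun e' he' => hw e' (by lia)
  · rw [hw e le_rfl]

/-- The message with index `K + b` is identified from the output `Y_j` by a terminal that knows the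
earlier messages. -/
def Decodes (s : Fin (B * m) → ∀ i, S i) (y : Fin (B + K) × Fin n → ∀ j, Y j) (b : Fin B) : Prop :=
  Identifies (fun m => 𝒞.test j (fun τ => y τ j) (fun k => s (finProdFinEquiv (b, k)) j.succ) b
    (Function.update (block K fun k => s k 0) (K + b) m)) fun k => s (finProdFinEquiv (b, k)) 0

open scoped Classical in
/-- The probability that the message with index `K + b` is not identified from the output `Y_j`, if
all inputs are as prescribed by the scheme. -/
def failureProb [∀ j, Fintype (Y j)] [∀ i, Fintype (S i)] (W : (∀ j, X j) → PMF (∀ j, Y j))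
    (q : PMF (∀ i, S i)) (b : Fin B) : ℝ :=
  ∑ s, (piPMF (fun _ : Fin (B * m) => q) s).toReal *
    ∑ y, (piPMF (fun τ => W (𝒞.input (block K fun k => s k 0) τ)) y).toReal *
      if 𝒞.Decodes j s y b then 0 else 1

variable {𝒞} {s : Fin (B * m) → ∀ i, S i}

lemma estimate_fullTest_eq {y : Fin (B + K) × Fin n → ∀ j, Y j} (h : ∀ b, 𝒞.Decodes j s y b)
    {e e' : ℕ} (he : e' < e) :
    estimate (𝒞.fullTest j (fun τ => y τ j) fun k => s k j.succ) e e' =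
      block K (fun k => s k 0) e' := by
  refine estimate_eq_of_lt (fun e w w' hw => ?_) (fun e m => ?_) he
  · exact 𝒞.fullTest_congr (fun _ _ => rfl) hw
  · unfold fullTest
    split_ifs with hrange
    · obtain ⟨b, rfl⟩ : ∃ b : Fin B, e = K + b := ⟨⟨e - K, by lia⟩, by lia⟩
      simp only [Nat.add_sub_cancel_left, block_add]
      exact h b m
    · simp only [Function.update_self, block_of_not _ hrange]

variable [∀ j, Nonempty (Y j)]

variable (𝒞) in
/-- The code in which the terminals use their decisions on the messages in place of the
messages. -/
def code : Code X Y S (B * m) ((B + K) * n) where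
  enc s t := 𝒞.input (block K s) (finProdFinEquiv.symm t) 0
  relay i t y σ :=
    let y' (τ : Fin (B + K) × Fin n) : Y i.castSucc :=
      if h : finProdFinEquiv τ < t then y ⟨finProdFinEquiv τ, h⟩ else Classical.arbitrary _
    𝒞.input (estimate (𝒞.fullTest i.castSucc y' σ) ((finProdFinEquiv.symm t).1 + K - i))
      (finProdFinEquiv.symm t) i.succ
  dec y σ k :=
    estimate (𝒞.fullTest (Fin.last K) (fun τ => y (finProdFinEquiv τ)) σ) (K + B)
      (K + (finProdFinEquiv.symm k).1) (finProdFinEquiv.symm k).2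

variable {y : Fin ((B + K) * n) → ∀ j, Y j}

lemma code_input_eq (h : ∀ j b, 𝒞.Decodes j s (fun τ => y (finProdFinEquiv τ)) b)
    (t : Fin ((B + K) * n)) :
    𝒞.code.input s y t = 𝒞.input (block K fun k => s k 0) (finProdFinEquiv.symm t) := by
  funext k
  induction k using Fin.cases with
  | zero => rfl
  | succ i =>
    refine 𝒞.input_congr fun e he => ?_
    rw [Fin.val_succ] at he
    refine (congrFun (estimate_congr fun e' he' => funext fun w => ?_) e).trans
      (estimate_fullTest_eq i.castSucc (h i.castSucc)
        (e := (finProdFinEquiv.symm t).1 + K - i) (by lia))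
    refine propext (𝒞.fullTest_congr (fun τ hτ => dif_pos (finProdFinEquiv_lt ?_)) fun _ _ => rfl)
    rw [Fin.val_castSucc] at hτ
    lia

lemma code_correct (h : ∀ j b, 𝒞.Decodes j s (fun τ => y (finProdFinEquiv τ)) b) :
    𝒞.code.Correct s y := by
  funext k
  have hlt : K + ((finProdFinEquiv.symm k).1 : ℕ) < K + B := by lia
  refine (congrFun (estimate_fullTest_eq (Fin.last K) (h (Fin.last K)) hlt) _).trans ?_
  simp only [block_add, Prod.mk.eta, Equiv.apply_symm_apply]

lemma errorProb_code_le [∀ j, Fintype (Y j)] [∀ i, Fintype (S i)]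
    (W : (∀ j, X j) → PMF (∀ j, Y j)) (q : PMF (∀ i, S i)) :
    𝒞.code.errorProb W q ≤ ∑ j, ∑ b, 𝒞.failureProb j W q b := by
  classical
  refine (𝒞.code.errorProb_le_of_input_eq W q
    (x := fun s t => 𝒞.input (block K fun k : Fin (B * m) => s k 0) (finProdFinEquiv.symm t))
    (fun s y h => code_input_eq h) fun s y h => code_correct h).trans ?_
  have hreindex (s : Fin (B * m) → ∀ i, S i) (F : (Fin (B + K) × Fin n → ∀ j, Y j) → ℝ) :
      ∑ y, (piPMF (fun t => W (𝒞.input (block K fun k => s k 0) (finProdFinEquiv.symm t))) y).toReal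
          * F (fun τ => y (finProdFinEquiv τ)) =
        ∑ y, (piPMF (fun τ => W (𝒞.input (block K fun k => s k 0) τ)) y).toReal * F y := by
    have h := sum_piPMF_mul_comp
      (fun t => W (𝒞.input (block K fun k => s k 0) (finProdFinEquiv.symm t)))
      (finProdFinEquiv (m := B + K) (n := n)).injective F
    simpa only [Equiv.symm_apply_apply] using h
  have hunion (s : Fin (B * m) → ∀ i, S i) (y : Fin (B + K) × Fin n → ∀ j, Y j) :=
    ite_forall_le_sum fun i : Fin (K + 1) × Fin B => 𝒞.Decodes i.1 s y i.2
  simp only [Prod.forall] at hunion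
  calc _ = ∑ s, (piPMF (fun _ : Fin (B * m) => q) s).toReal *
        ∑ y, (piPMF (fun τ => W (𝒞.input (block K fun k => s k 0) τ)) y).toReal *
          if ∀ j b, 𝒞.Decodes j s y b then 0 else 1 :=
        Finset.sum_congr rfl fun s _ => congrArg _
          (hreindex s fun y => if ∀ j b, 𝒞.Decodes j s y b then 0 else 1)
    _ ≤ ∑ s, (piPMF (fun _ : Fin (B * m) => q) s).toReal *
        ∑ y, (piPMF (fun τ => W (𝒞.input (block K fun k => s k 0) τ)) y).toReal *
          ∑ i : Fin (K + 1) × Fin B, if 𝒞.Decodes i.1 s y i.2 then 0 else 1 := by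
        gcongr with s _ y _
        exact hunion s y
    _ = ∑ i : Fin (K + 1) × Fin B, 𝒞.failureProb i.1 W q i.2 := by
        simp only [failureProb, Finset.mul_sum]
        exact (Finset.sum_congr rfl fun s _ => Finset.sum_comm).trans Finset.sum_comm
    _ = _ := Fintype.sum_prod_type _

end BlockScheme

end BlockScheme

section BlockScore

variable {Ω A B : Type*} (μ : PMF Ω) (f : Ω → A) (g : Ω → B) {m : ℕ}

/-- The conditional probability of a block of values of `f` given a block of values of `g`, for
independent samples. -/
def blockScore (σ : Fin m → B) (v : Fin m → A) : ℝ :=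
  ∏ k, condProb μ f g (v k) (σ k)

lemma blockScore_nonneg (σ : Fin m → B) (v : Fin m → A) : 0 ≤ blockScore μ f g σ v :=
  Finset.prod_nonneg fun _ _ => condProb_nonneg μ f g _ _

lemma blockScore_pos {s : Fin m → Ω} (hs : ∀ k, 0 < (μ (s k)).toReal) :
    0 < blockScore μ f g (fun k => g (s k)) fun k => f (s k) :=
  Finset.prod_pos fun k _ => condProb_pos μ f g (hs k)

lemma sum_blockScore_le_one [Fintype A] [Finite B] (σ : Fin m → B) :
    ∑ v, blockScore μ f g σ v ≤ 1 := by
  simp only [blockScore]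
  rw [← Fintype.prod_sum fun k a => condProb μ f g a (σ k)]
  exact Finset.prod_le_one (fun k _ => Finset.sum_nonneg fun a _ => condProb_nonneg μ f g a (σ k))
    fun k _ => sum_condProb_le_one μ f g (σ k)

lemma identifies_blockScore_pos [Finite Ω] [Fintype A] [Fintype B] (h : condEntropy μ f g = 0)
    {s : Fin m → Ω} (hs : ∀ k, 0 < (μ (s k)).toReal) :
    Identifies (fun v => 0 < blockScore μ f g (fun k => g (s k)) v) fun k => f (s k) := by
  classical
  have := Fintype.ofFinite Ω
  have hone (ω) (hω : 0 < (μ ω).toReal) : condProb μ f g (f ω) (g ω) = 1 := by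
    rw [condEntropy_eq_sum, Finset.sum_eq_zero_iff_of_nonneg fun ω _ =>
      mul_nonneg ENNReal.toReal_nonneg (neg_nonneg.2 (Real.log_nonpos
        (condProb_nonneg μ f g _ _) (condProb_le_one μ f g _ _)))] at h
    have hlog := (mul_eq_zero.1 (h ω (Finset.mem_univ ω))).resolve_left hω.ne'
    exact Real.eq_one_of_pos_of_log_eq_zero (condProb_pos μ f g hω) (neg_eq_zero.1 hlog)
  refine fun v => ⟨fun hv => funext fun k => ?_, fun hv => hv ▸ blockScore_pos μ f g hs⟩
  by_contra hk
  have hpos : condProb μ f g (v k) (g (s k)) ≠ 0 :=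
    Finset.prod_ne_zero_iff.1 hv.ne' k (Finset.mem_univ k)
  have hpair := (Finset.sum_le_sum_of_subset_of_nonneg (Finset.subset_univ {v k, f (s k)})
    fun a _ _ => condProb_nonneg μ f g a (g (s k))).trans (sum_condProb_le_one μ f g (g (s k)))
  rw [Finset.sum_pair hk, hone _ (hs k)] at hpair
  exact hpos (le_antisymm (by linarith) (condProb_nonneg μ f g _ _))

variable [Fintype Ω]

/-- The moment of order `-l` of the conditional probability of `f` given `g`. -/
def scoreMoment (l : ℝ) : ℝ :=
  ∑ ω, (μ ω).toReal * condProb μ f g (f ω) (g ω) ^ (-l)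

lemma scoreMoment_nonneg (l : ℝ) : 0 ≤ scoreMoment μ f g l :=
  Finset.sum_nonneg fun _ _ => mul_nonneg ENNReal.toReal_nonneg
    (Real.rpow_nonneg (condProb_nonneg μ f g _ _) _)

lemma eventually_scoreMoment_le [Fintype A] [Fintype B] {ε : ℝ} (hε : 0 < ε) :
    ∀ᶠ l in 𝓝[>] (0 : ℝ), scoreMoment μ f g l ≤ Real.exp (l * (condEntropy μ f g + ε)) := by
  filter_upwards [eventually_sum_rpow_neg_le μ (fun ω hω => condProb_pos μ f g hω) hε] with l hl
  refine hl.trans_eq ?_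
  simp only [condEntropy_eq_sum, mul_neg, Finset.sum_neg_distrib]
  ring_nf

lemma sum_mul_blockScore_rpow (l : ℝ) : ∑ s, (piPMF (fun _ : Fin m => μ) s).toReal *
    blockScore μ f g (fun k => g (s k)) (fun k => f (s k)) ^ (-l) = scoreMoment μ f g l ^ m := by
  simp only [blockScore, ← Real.finsetProd_rpow _ _ fun _ _ => condProb_nonneg μ f g _ _]
  rw [sum_piPMF_mul_prod (fun _ => μ) fun _ ω => condProb μ f g (f ω) (g ω) ^ (-l)]
  simp [scoreMoment]

end BlockScore

section Superposition

variable {K B n : ℕ} {M : Type*}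

/-- The messages which the terminals represent by their letters in the block `a`, when the
sequence of messages is `w`: in every block, each terminal moves on to the next message. -/
def messages (w : ℕ → M) (a : ℕ) : Fin (K + 1) → M :=
  fun k => w (a + K - k)

/-- The channel use in which the letter of the terminal `T_k`, `k ≤ j`, at the position `i.2`
represents the message with index `K + b`. -/
def slot (j : Fin (K + 1)) (b : Fin B) (i : Finset.Iic j × Fin n) : Fin (B + K) × Fin n :=
  (⟨b + i.1.1, by lia⟩, i.2)

lemma slot_injective (j : Fin (K + 1)) (b : Fin B) : (slot (n := n) j b).Injective := by
  rintro ⟨k, t⟩ ⟨k', t'⟩ h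
  simp only [slot, Prod.mk.injEq, Fin.mk.injEq, Nat.add_left_cancel_iff] at h
  exact Prod.ext (Subtype.ext (Fin.ext h.1)) h.2

lemma messages_update (w : ℕ → M) (m : M) (b : ℕ) (k : Fin (K + 1)) :
    messages (Function.update w (K + b) m) (b + k) =
      Function.update (messages w (b + k) : Fin (K + 1) → M) k m := by
  funext i
  rcases eq_or_ne i k with rfl | hi
  · rw [Function.update_self, messages, show b + i + K - i = K + b by lia, Function.update_self]
  · rw [Function.update_of_ne hi, messages, Function.update_of_ne, messages]
    have := Fin.val_ne_of_ne hi
    lia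

lemma select_messages_congr {U : Fin (K + 1) → Type*} (c : ∀ i : Fin (K + 1) × M, U i.1)
    {w w' : ℕ → M} {a : ℕ} {k : Fin (K + 1)} (h : w (a + K - k) = w' (a + K - k)) :
    select c (messages w a) k = select c (messages w' a) k := by
  rw [select, select, messages, messages, h]

variable {U Y : Fin (K + 1) → Type*} [∀ k, Fintype (U k)] (V : (∀ k, U k) → PMF (∀ k, Y k))
  (π : ∀ k, PMF (U k))

lemma windowDensity_messages_congr {j : Fin (K + 1)} {b : Fin B} {w w' : ℕ → M}
    {y y' : Fin (B + K) × Fin n → Y j} (hw : ∀ e ≤ K + b, w e = w' e)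
    (hy : ∀ τ, (τ.1 : ℕ) ≤ b + j → y τ = y' τ)
    (C : Fin (B + K) × Fin n → ∀ i : Fin (K + 1) × M, U i.1) :
    windowDensity V π j (fun i => i.1) (fun i => messages w (slot j b i).1)
        (fun i => C (slot j b i)) (fun i => y (slot j b i)) =
      windowDensity V π j (fun i => i.1) (fun i => messages w' (slot j b i).1)
        (fun i => C (slot j b i)) fun i => y' (slot j b i) := by
  refine Finset.prod_congr rfl fun i _ => ?_
  have hi := Fin.le_def.1 (Finset.mem_Iic.1 i.1.2)
  dsimp only
  rw [hy (slot j b i) (Nat.add_le_add_left hi b)]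
  refine letterDensity_congr _ _ (fun k hk => select_messages_congr _ (hw _ ?_)) _
  have := Fin.le_def.1 hk
  simp only [slot]
  lia

variable [∀ k, Fintype (Y k)] [Fintype M] [DecidableEq M]

lemma sum_book_mul_sum_output {I J : Type*} [Fintype I] [DecidableEq I] [Fintype J]
    [DecidableEq J] (w : I → Fin (K + 1) → M) {e : J → I} (he : e.Injective)
    (F : (J → (∀ i : Fin (K + 1) × M, U i.1) × (∀ k, Y k)) → ℝ) :
    ∑ C, (piPMF (fun _ : I => piPMF fun i : Fin (K + 1) × M => π i.1) C).toReal *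
      ∑ y, (piPMF (fun τ => V (select (C τ) (w τ))) y).toReal * F (fun i => (C (e i), y (e i))) =
    ∑ z, (piPMF (fun i => slotLaw V π (w (e i))) z).toReal * F z := by
  rw [← sum_piPMF_mul_comp (fun τ => slotLaw V π (w τ)) he,
    ← (Equiv.arrowProdEquivProdArrow I _ _).symm.sum_comp, Fintype.sum_prod_type]
  simp only [Finset.mul_sum, toReal_piPMF_apply, Equiv.arrowProdEquivProdArrow_symm_apply,
    toReal_slotLaw_apply, Finset.prod_mul_distrib, mul_assoc]

open scoped Classical in
lemma sum_book_not_identifies_le (w : ℕ → M) (j : Fin (K + 1)) (b : Fin B) {score : M → ℝ}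
    (hscore : ∀ m, 0 ≤ score m) (hscore_sum : ∑ m, score m ≤ 1) (hpos : 0 < score (w (K + b)))
    {θ l : ℝ} (hθ : 0 < θ) (hl : 0 < l) :
    ∑ C, (piPMF (fun _ : Fin (B + K) × Fin n =>
      piPMF fun i : Fin (K + 1) × M => π i.1) C).toReal *
      ∑ y, (piPMF (fun τ => V (select (C τ) (messages w τ.1))) y).toReal *
        (if Identifies (fun m => θ ≤ score m * windowDensity V π j (fun i => i.1)
          (fun i => messages (Function.update w (K + b) m) (slot j b i).1)
          (fun i => C (slot j b i)) fun i => y (slot j b i) j) (w (K + b)) then 0 else 1) ≤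
      θ ^ l * (score (w (K + b)) ^ (-l) *
        (∏ k ∈ Finset.Iic j, letterMoment V (piPMF π) j k l) ^ n) + θ⁻¹ := by
  have hw (i : Finset.Iic j × Fin n) : messages w (slot j b i).1 i.1.1 = w (K + b) :=
    congrArg w (by simp only [slot]; lia)
  have hmetric (m : M) (C : Fin (B + K) × Fin n → ∀ i : Fin (K + 1) × M, U i.1)
      (y : Fin (B + K) × Fin n → ∀ k, Y k) : score m * windowDensity V π j (fun i => i.1)
        (fun i => messages (Function.update w (K + b) m) (slot j b i).1)
        (fun i => C (slot j b i)) (fun i => y (slot j b i) j) =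
      metric V π j (fun i => i.1) (fun i => messages w (slot j b i).1) score m
        (fun i => C (slot j b i)) fun i => y (slot j b i) j := by
    simp only [metric, slot, messages_update]
  have hprod : ∏ i : Finset.Iic j × Fin n, letterMoment V (piPMF π) j i.1 l =
      (∏ k ∈ Finset.Iic j, letterMoment V (piPMF π) j k l) ^ n := by
    rw [Fintype.prod_prod_type, ← Finset.prod_pow]
    simp only [Finset.prod_const, Finset.card_univ, Fintype.card_fin]
    exact Finset.prod_coe_sort (Finset.Iic j) fun k => letterMoment V (piPMF π) j k l ^ n
  have hbound := sum_not_identifies_metric_le V π j (fun i : Finset.Iic j × Fin n => i.1)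
    (fun i => messages w (slot j b i).1) hscore hscore_sum hpos hw hθ hl
  rw [← sum_book_mul_sum_output V π (fun τ : Fin (B + K) × Fin n => messages w τ.1)
    (slot_injective j b), hprod] at hbound
  convert hbound using 9 with C _ y
  exact hmetric _ C y

end Superposition

section DecodeForward

lemma sum_mul_sum_mul_comm {A B : Type*} [Fintype A] [Fintype B] (f : A → ℝ) (g : B → ℝ)
    (F : A → B → ℝ) : ∑ a, f a * ∑ b, g b * F a b = ∑ b, g b * ∑ a, f a * F a b := by
  simp only [Finset.mul_sum]
  rw [Finset.sum_comm]
  exact Finset.sum_congr rfl fun b _ => Finset.sum_congr rfl fun a _ => mul_left_comm _ _ _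

variable {K B m n : ℕ} {X Y U : Fin (K + 1) → Type*} {S : Fin (K + 2) → Type*}
  [∀ k, Fintype (U k)] [∀ i, Fintype (S i)] (W : (∀ k, X k) → PMF (∀ k, Y k)) (q : PMF (∀ i, S i))
  (π : ∀ k, PMF (U k)) {φ : (∀ k, U k) → ∀ k, X k}
  (hφ : ∀ k, DependsOn (fun u => φ u k) (Set.Ici k)) (θ : Fin (K + 1) → ℝ)

/-- Block Markov decode-and-forward with the codebook `C`, where `C τ (k, v)` is the letter by
which the terminal `T_k` represents the message `v` in the channel use `τ`, and with sliding window
decoding. -/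
def decodeForward (C : Fin (B + K) × Fin n → ∀ i : Fin (K + 1) × (Fin m → S 0), U i.1) :
    BlockScheme X Y S B m n where
  input w τ := φ (select (C τ) (messages w τ.1))
  input_congr h := by
    refine hφ _ fun i hi => select_messages_congr _ (h _ ?_)
    have := Fin.le_def.1 hi
    lia
  test j y σ b w :=
    if condEntropy q (fun s => s 0) (fun s => s j.succ) = 0 then
      0 < blockScore q (fun s => s 0) (fun s => s j.succ) σ (w (K + b))
    else θ j ≤ blockScore q (fun s => s 0) (fun s => s j.succ) σ (w (K + b)) *
      windowDensity (fun u => W (φ u)) π j (fun i => i.1) (fun i => messages w (slot j b i).1)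
        (fun i => C (slot j b i)) fun i => y (slot j b i)
  test_congr hy hw := by rw [windowDensity_messages_congr _ _ hw hy, hw _ le_rfl]

variable [∀ k, Fintype (Y k)] [∀ i, Nonempty (S i)] (j : Fin (K + 1)) (b : Fin B)

lemma failureProb_decodeForward_eq_zero
    (h : condEntropy q (fun s => s 0) (fun s => s j.succ) = 0)
    (C : Fin (B + K) × Fin n → ∀ i : Fin (K + 1) × (Fin m → S 0), U i.1) :
    (decodeForward W q π hφ θ C).failureProb j W q b = 0 := by
  refine Finset.sum_eq_zero fun s _ => ?_
  rcases (ENNReal.toReal_nonneg (a := piPMF (fun _ => q) s)).eq_or_lt with hs | hs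
  · rw [← hs, zero_mul]
  · have hdecodes (y) : (decodeForward W q π hφ θ C).Decodes j s y b := by
      simp only [BlockScheme.Decodes, decodeForward, if_pos h, Function.update_self]
      exact identifies_blockScore_pos q _ _ h fun k => toReal_pos_of_piPMF_pos hs _
    simp only [hdecodes, if_true, mul_zero, Finset.sum_const_zero]

open scoped Classical in
lemma sum_mul_failureProb_decodeForward_le
    (h : condEntropy q (fun s => s 0) (fun s => s j.succ) ≠ 0) (hθ : 0 < θ j) {l : ℝ}
    (hl : 0 < l) :
    ∑ C, (piPMF (fun _ : Fin (B + K) × Fin n =>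
      piPMF fun i : Fin (K + 1) × (Fin m → S 0) => π i.1) C).toReal *
        (decodeForward W q π hφ θ C).failureProb j W q b ≤
      θ j ^ l * (scoreMoment q (fun s => s 0) (fun s => s j.succ) l ^ m *
        (∏ k ∈ Finset.Iic j, letterMoment (fun u => W (φ u)) (piPMF π) j k l) ^ n) + (θ j)⁻¹ := by
  set L := ∏ k ∈ Finset.Iic j, letterMoment (fun u => W (φ u)) (piPMF π) j k l
  let score (s : Fin m → ∀ i, S i) : ℝ :=
    blockScore q (fun s => s 0) (fun s => s j.succ) (fun k => s k j.succ) fun k => s k 0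
  have hcond (s : Fin (B * m) → ∀ i, S i) (hs : 0 < (piPMF (fun _ => q) s).toReal) := by
    have hscore : 0 < score fun k => s (finProdFinEquiv (b, k)) :=
      blockScore_pos q _ _ fun k => toReal_pos_of_piPMF_pos hs _
    have := sum_book_not_identifies_le (fun u => W (φ u)) π (n := n)
      (block K fun k : Fin (B * m) => s k 0) j b
      (score := blockScore q (fun s => s 0) (fun s => s j.succ)
        fun k => s (finProdFinEquiv (b, k)) j.succ)
      (blockScore_nonneg q _ _ _) (sum_blockScore_le_one q _ _ _) (by rwa [block_add]) hθ hl
    rwa [block_add] at this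
  calc _ = ∑ s, (piPMF (fun _ => q) s).toReal * ∑ C, (piPMF (fun _ : Fin (B + K) × Fin n =>
          piPMF fun i : Fin (K + 1) × (Fin m → S 0) => π i.1) C).toReal *
        ∑ y, (piPMF (fun τ => W ((decodeForward W q π hφ θ C).input
          (block K fun k => s k 0) τ)) y).toReal *
            if (decodeForward W q π hφ θ C).Decodes j s y b then 0 else 1 :=
        sum_mul_sum_mul_comm _ _ _
    _ ≤ ∑ s, (piPMF (fun _ => q) s).toReal *
        (θ j ^ l * (score (fun k => s (finProdFinEquiv (b, k))) ^ (-l) * L ^ n) + (θ j)⁻¹) := by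
        refine Finset.sum_le_sum fun s _ => ?_
        rcases (ENNReal.toReal_nonneg (a := piPMF (fun _ => q) s)).eq_or_lt with hs | hs
        · rw [← hs, zero_mul, zero_mul]
        · refine mul_le_mul_of_nonneg_left (le_trans (le_of_eq ?_) (hcond s hs)) hs.le
          simp only [BlockScheme.Decodes, decodeForward, if_neg h, Function.update_self]
    _ = _ := by
        rw [sum_piPMF_mul_comp (fun _ => q) (fun k k' hk => by simpa using hk)
          fun s => θ j ^ l * (score s ^ (-l) * L ^ n) + (θ j)⁻¹]
        simp only [mul_add, Finset.sum_add_distrib, ← Finset.sum_mul, sum_toReal_eq_one, one_mul,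
          mul_left_comm _ (θ j ^ l), ← mul_assoc _ _ (L ^ n), ← Finset.mul_sum, score,
          sum_mul_blockScore_rpow]

end DecodeForward

section Rate

lemma pow_mul_pow_le_exp {M L l H I ε r : ℝ} {m n : ℕ} (hM₀ : 0 ≤ M)
    (hM : M ≤ Real.exp (l * (H + ε))) (hL₀ : 0 ≤ L) (hL : L ≤ Real.exp (-l * (I - ε)))
    (hl : 0 ≤ l * (H + ε)) (hm : m ≤ r * n + 1) :
    M ^ m * L ^ n ≤ Real.exp (l * (H + ε)) * Real.exp (-l * (I - r * H - (1 + r) * ε) * n) := by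
  calc M ^ m * L ^ n ≤ Real.exp (l * (H + ε)) ^ m * Real.exp (-l * (I - ε)) ^ n := by gcongr
    _ = Real.exp (l * (H + ε) * m + -l * (I - ε) * n) := by
        rw [← Real.exp_nat_mul, ← Real.exp_nat_mul, ← Real.exp_add, mul_comm (m : ℝ),
          mul_comm (n : ℝ)]
    _ ≤ Real.exp (l * (H + ε) * (r * n + 1) + -l * (I - ε) * n) := by gcongr
    _ = _ := by
        rw [← Real.exp_add]
        ring_nf

lemma tendsto_exp_neg_mul_natCast {a : ℝ} (ha : 0 < a) :
    Tendsto (fun n : ℕ => Real.exp (-a * n)) atTop (𝓝 0) := by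
  simp only [neg_mul]
  exact Real.tendsto_exp_neg_atTop_nhds_zero.comp (tendsto_natCast_atTop_atTop.const_mul_atTop ha)

variable {K : ℕ} {U Y : Fin (K + 1) → Type*} [∀ k, Fintype (U k)] [∀ k, Fintype (Y k)]
  {Ω A B : Type*} [Fintype Ω] [Fintype A] [Fintype B]

lemma exists_threshold (V : (∀ k, U k) → PMF (∀ k, Y k)) (P : PMF (∀ k, U k)) (j : Fin (K + 1))
    (μ : PMF Ω) (f : Ω → A) (g : Ω → B) {r : ℝ} (hr : 0 ≤ r)
    (h : r * condEntropy μ f g < cutInfo V P j) :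
    ∃ (l : ℝ) (θ err : ℕ → ℝ), 0 < l ∧ (∀ n, 0 < θ n) ∧ (∀ n, 0 ≤ err n) ∧
      Tendsto err atTop (𝓝 0) ∧ ∀ n m : ℕ, m ≤ r * n + 1 → θ n ^ l * (scoreMoment μ f g l ^ m *
        (∏ k ∈ Finset.Iic j, letterMoment V P j k l) ^ n) + (θ n)⁻¹ ≤ err n := by
  set H := condEntropy μ f g
  set D := cutInfo V P j - r * H with hD
  have : 0 < D := sub_pos.2 h
  obtain ⟨ε, hε, hεD⟩ : ∃ ε > 0, (1 + r) * ε = D / 4 :=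
    ⟨D / 4 / (1 + r), by positivity, mul_div_cancel₀ _ (by positivity)⟩
  obtain ⟨l, ⟨hletter, hscore⟩, hl⟩ := ((eventually_prod_letterMoment_le V P j hε).and
    (eventually_scoreMoment_le μ f g hε)).and self_mem_nhdsWithin |>.exists
  have hH : 0 ≤ H := condEntropy_nonneg _ _ _
  refine ⟨l, fun n => Real.exp (D / 4 * n), fun n => Real.exp (l * (H + ε)) *
    Real.exp (-(l * (D / 2)) * n) + Real.exp (-(D / 4) * n), hl, fun n => Real.exp_pos _,
    fun n => by positivity, ?_, fun n m hm => add_le_add ?_ (by rw [← Real.exp_neg, neg_mul])⟩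
  · simpa using ((tendsto_exp_neg_mul_natCast (by positivity : 0 < l * (D / 2))).const_mul
      (Real.exp (l * (H + ε)))).add (tendsto_exp_neg_mul_natCast (by positivity : 0 < D / 4))
  · rw [← Real.exp_mul]
    calc _ ≤ Real.exp (D / 4 * n * l) * (Real.exp (l * (H + ε)) * Real.exp (-l *
          (cutInfo V P j - r * H - (1 + r) * ε) * n)) := by
          refine mul_le_mul_of_nonneg_left ?_ (Real.exp_pos _).le
          exact pow_mul_pow_le_exp (scoreMoment_nonneg μ f g l) hscore
            (Finset.prod_nonneg fun k _ => letterMoment_nonneg V P j k l) hletter (by positivity) hm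
      _ = _ := by
          rw [← hD, hεD, mul_left_comm, ← Real.exp_add]
          ring_nf

lemma le_mul_ceil_div {a r : ℝ} {b K n : ℕ} (hn : 0 < n) (hb : 0 < b)
    (h : a * (b + K) ≤ b * r) : a ≤ (b * ⌈r * n⌉₊ : ℕ) / ((b + K) * n : ℕ) := by
  rw [le_div_iff₀ (by positivity)]
  push_cast
  calc a * ((b + K) * n) = a * (b + K) * n := by ring
    _ ≤ b * r * n := by gcongr
    _ = b * (r * n) := by ring
    _ ≤ b * ⌈r * n⌉₊ := by gcongr; exact Nat.le_ceil _

end Rate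

section Achievability

variable {K : ℕ} {X Y U : Fin (K + 1) → Type*} {S : Fin (K + 2) → Type*}
  [∀ k, Fintype (U k)] [∀ k, Fintype (Y k)] [∀ i, Fintype (S i)]
  (W : (∀ k, X k) → PMF (∀ k, Y k)) (q : PMF (∀ i, S i)) (π : ∀ k, PMF (U k))
  {φ : (∀ k, U k) → ∀ k, X k}

lemma exists_code_errorProb_le (hφ : ∀ k, DependsOn (fun u => φ u k) (Set.Ici k)) (B : ℕ)
    {m n : ℕ} {θ l err : Fin (K + 1) → ℝ} (hθ : ∀ j, 0 < θ j) (hl : ∀ j, 0 < l j)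
    (herr : ∀ j, 0 ≤ err j)
    (h : ∀ j, condEntropy q (fun s => s 0) (fun s => s j.succ) ≠ 0 → θ j ^ l j *
      (scoreMoment q (fun s => s 0) (fun s => s j.succ) (l j) ^ m *
        (∏ k ∈ Finset.Iic j, letterMoment (fun u => W (φ u)) (piPMF π) j k (l j)) ^ n) +
          (θ j)⁻¹ ≤ err j) :
    ∃ c : Code X Y S (B * m) ((B + K) * n), c.errorProb W q ≤ B * ∑ j, err j := by
  classical
  obtain ⟨u⟩ := nonempty_of_pmf (piPMF π)
  have := Classical.nonempty_pi.1 (nonempty_of_pmf q)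
  have := Classical.nonempty_pi.1 (nonempty_of_pmf (W (φ u)))
  set book := piPMF fun _ : Fin (B + K) × Fin n =>
    piPMF fun i : Fin (K + 1) × (Fin m → S 0) => π i.1
  have hfailure (j) (b : Fin B) :
      ∑ C, (book C).toReal * (decodeForward W q π hφ θ C).failureProb j W q b ≤ err j := by
    by_cases hj : condEntropy q (fun s => s 0) (fun s => s j.succ) = 0
    · simpa only [failureProb_decodeForward_eq_zero W q π hφ θ j b hj, mul_zero,
        Finset.sum_const_zero] using herr j
    · exact (sum_mul_failureProb_decodeForward_le W q π hφ θ j b hj (hθ j) (hl j)).trans (h j hj)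
  obtain ⟨C, hC⟩ := exists_le_of_sum_mul_le book
    (f := fun C => ∑ j, ∑ b, (decodeForward W q π hφ θ C).failureProb j W q b)
    (b := B * ∑ j, err j) <| by
      calc _ = ∑ j, ∑ b : Fin B,
            ∑ C, (book C).toReal * (decodeForward W q π hφ θ C).failureProb j W q b := by
            simp only [Finset.mul_sum]
            rw [Finset.sum_comm]
            exact Finset.sum_congr rfl fun j _ => Finset.sum_comm
        _ ≤ ∑ j, ∑ _b : Fin B, err j :=
            Finset.sum_le_sum fun j _ => Finset.sum_le_sum fun b _ => hfailure j b
        _ = _ := by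
            simp only [Finset.sum_const, Finset.card_univ, Fintype.card_fin, nsmul_eq_mul,
              Finset.mul_sum]
  exact ⟨_, ((decodeForward W q π hφ θ C).errorProb_code_le W q).trans hC⟩

lemma achievable_of_lt (hφ : ∀ k, DependsOn (fun u => φ u k) (Set.Ici k)) {a : ℝ≥0} {r : ℝ}
    (har : a < r)
    (h : ∀ j : Fin (K + 1), condEntropy q (fun s => s 0) (fun s => s j.succ) ≠ 0 →
      r * condEntropy q (fun s => s 0) (fun s => s j.succ) <
        cutInfo (fun u => W (φ u)) (piPMF π) j) :
    Achievable W q a := by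
  have hr : 0 < r := a.2.trans_lt har
  have hthreshold (j : Fin (K + 1)) : ∃ (l : ℝ) (θ err : ℕ → ℝ), 0 < l ∧ (∀ n, 0 < θ n) ∧
      (∀ n, 0 ≤ err n) ∧ Tendsto err atTop (𝓝 0) ∧ ∀ n m : ℕ, m ≤ r * n + 1 →
        condEntropy q (fun s => s 0) (fun s => s j.succ) ≠ 0 → θ n ^ l *
          (scoreMoment q (fun s => s 0) (fun s => s j.succ) l ^ m *
            (∏ k ∈ Finset.Iic j, letterMoment (fun u => W (φ u)) (piPMF π) j k l) ^ n) +
              (θ n)⁻¹ ≤ err n := by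
    by_cases hj : condEntropy q (fun s => s 0) (fun s => s j.succ) = 0
    · exact ⟨1, 1, 0, one_pos, fun _ => one_pos, fun _ => le_rfl, tendsto_const_nhds,
        fun _ _ _ h => absurd hj h⟩
    · obtain ⟨l, θ, err, hl, hθ, herr, hlim, hbound⟩ :=
        exists_threshold (fun u => W (φ u)) (piPMF π) j q _ _ hr.le (h j hj)
      exact ⟨l, θ, err, hl, hθ, herr, hlim, fun n m hm _ => hbound n m hm⟩
  choose l θ err hl hθ herr hlim hbound using hthreshold
  -- The `K` blocks in which the relays catch up cost the factor `B / (B + K)` in the rate.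
  obtain ⟨B, hB⟩ := exists_nat_gt (a * K / (r - a))
  have hB₀ : 0 < B := by exact_mod_cast (by positivity : 0 ≤ a * K / (r - a)).trans_lt hB
  rw [div_lt_iff₀ (sub_pos.2 har)] at hB
  have hcode (k : ℕ) := exists_code_errorProb_le W q π hφ B (m := ⌈r * (k + 1 : ℕ)⌉₊)
    (fun j => hθ j (k + 1)) hl (fun j => herr j (k + 1)) fun j =>
      hbound j (k + 1) _ (Nat.ceil_lt_add_one (by positivity)).le
  choose c hc using hcode
  have hsucc := tendsto_add_atTop_nat 1
  refine ⟨_, _, c, fun k => ⟨by positivity, le_mul_ceil_div k.succ_pos hB₀ (by linarith)⟩,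
    ?_, ?_, ?_⟩
  · exact (tendsto_nat_ceil_atTop.comp ((tendsto_natCast_atTop_atTop.comp hsucc).const_mul_atTop
      hr)).const_mul_atTop' hB₀
  · exact hsucc.const_mul_atTop' (by lia)
  · refine squeeze_zero (fun k => (c k).errorProb_nonneg W q) hc ?_
    simpa using (tendsto_finsetSum Finset.univ fun j _ => (hlim j).comp hsucc).const_mul (B : ℝ)

end Achievability

section Capacity

variable {K : ℕ} {X Y : Fin (K + 1) → Type*} {S : Fin (K + 2) → Type*}
  [∀ k, Fintype (X k)] [∀ k, Fintype (Y k)] [∀ i, Fintype (S i)]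

lemma le_sourceChannelCapacity (W : (∀ k, X k) → PMF (∀ k, Y k)) (p : PMF (∀ k, X k))
    (q : PMF (∀ i, S i)) : ⨅ j : Fin (K + 1),
      ratio (cutInfo W p j) (condEntropy q (fun s => s 0) (fun s => s j.succ)) ≤
    sourceChannelCapacity W q := by
  obtain ⟨U, _, π, φ, hφ, hinfo⟩ := exists_independent_letters W p
  refine le_of_forall_lt_imp_le_of_dense fun a ha => ?_
  lift a to ℝ≥0 using (ha.trans_le le_top).ne
  refine le_iSup₂_of_le a ?_ le_rfl
  set H : Fin (K + 1) → ℝ := fun j => condEntropy q (fun s => s 0) (fun s => s j.succ)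
  have hH (j) : 0 ≤ H j := condEntropy_nonneg _ _ _
  have hslack (j) : ∃ r : ℝ, a < r ∧ (H j ≠ 0 → r * H j < cutInfo W p j) := by
    by_cases hj : H j = 0
    · exact ⟨a + 1, lt_add_one _, fun h => absurd hj h⟩
    · have hlt := ha.trans_le (iInf_le _ j)
      rw [ratio, if_neg hj, ← ENNReal.ofReal_coe_nnreal, ENNReal.ofReal_lt_ofReal_iff'] at hlt
      obtain ⟨r, har, hr⟩ := exists_between hlt.1
      exact ⟨r, har, fun _ => (lt_div_iff₀ ((hH j).lt_of_ne' hj)).1 hr⟩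
  choose r har hr using hslack
  obtain ⟨i, hi⟩ := Finite.exists_min r
  refine achievable_of_lt W q π hφ (har i) fun j hj => ?_
  rw [hinfo]
  exact (mul_le_mul_of_nonneg_right (hi j) (hH j)).trans_lt (hr j hj)

end Capacity

end

end RelayNetwork

theorem theorem2 {K : ℕ} {X Y : Fin (K + 1) → Type*} {S : Fin (K + 2) → Type*}
    [∀ j, Fintype (X j)] [∀ j, Fintype (Y j)] [∀ i, Fintype (S i)]
    (W : (∀ j, X j) → PMF (∀ j, Y j)) (q : PMF (∀ i, S i))
    (hW : RelayNetwork.PhysicallyDegraded W) (hq : RelayNetwork.DegradedSideInfo q) :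
    RelayNetwork.sourceChannelCapacity W q =
      ⨆ p : PMF (∀ j, X j), ⨅ j : Fin (K + 1),
        RelayNetwork.ratio (RelayNetwork.cutInfo W p j)
          (RelayNetwork.condEntropy q (fun s => s 0) (fun s => s j.succ)) :=
  le_antisymm (RelayNetwork.sourceChannelCapacity_le hW hq)
    (iSup_le fun p => RelayNetwork.le_sourceChannelCapacity W p q)
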